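/- Let $\alpha>-\tfrac12$. For $N\in\mathbb N=\{1,2,\dots\}$ put $$n(\alpha,N):=\tfrac12-\alpha+\tfrac12\sqrt{(2\alpha+1)(2\alpha+2N+1)} ,\qquad \omega(i):=\binom{\alpha+i}{i}\binom{\alpha+N-i}{N-i}\quad(i=0,\dots,N),$$ let $\langle g,h\rangle_\omega:=\sum_{i=0}^N g(i)h(i)\omega(i)$, and for $k=0,\dots,N$ let $$Q_k(x):=Q_k(x;\alpha,\alpha,N)=\sum_{j=0}^k\frac{(-k)_j\,(k+2\alpha+1)_j\,(-x)_j}{(\alpha+1)_j\,(-N)_j\,j!}$$ be the Hahn polynomials, where $(a)_j=a(a+1)\cdots(a+j-1)$. For $f\in\mathcal C[-1,1]$ let $$S_n^N[f](x):=\sum_{k=0}^n\frac{\langle f(\frac2N(\cdot)-1),Q_k\rangle_\omega}{\langle Q_k,Q_k\rangle_\omega}\,Q_k\!\left(\tfrac N2(1+x)\right).$$ Then there is a sequence $(\varepsilon_n)_{n\ge1}$ of real numbers, depending only on $\alpha$ (and not on $N$ or $f$), with $\varepsilon_n=\mathcal O(n^{-1})$ as $n\to\infty$, such that for all integers $n\ge1$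 and $N\ge1$ with $n+1\le n(\alpha,N)$ and every $f\in\mathcal C^{n+1}[-1,1]$, $$\sup_{x\in[-1,1]}\bigl|f(x)-S_n^N[f](x)\bigr|\le\sup_{x\in[-1,1]}\bigl|f^{(n+1)}(x)\bigr|\cdot\frac{\sqrt{\pi n}}{2^{n+1}(n+1)!}\cdot\frac{n^\alpha}{\Gamma(\alpha+1)2^{2\alpha}}\,(1+\varepsilon_n).$$ -/

import Mathlib

open Filter Asymptotics

noncomputable section

/-- The Pochhammer symbol `(a)_k = a (a + 1) ⋯ (a + k - 1)`. -/
def pochhammer (a : ℝ) (k : ℕ) : ℝ :=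
  (ascPochhammer ℝ k).eval a

/-- The Hahn polynomial `Q_n(x; α, β, N)`, as the terminating hypergeometric series
`₃F₂(-n, n + α + β + 1, -x; α + 1, -N; 1)` (meant for `n ≤ N` and `α, β > -1`). -/
def hahnQ (n : ℕ) (α β : ℝ) (N : ℕ) (x : ℝ) : ℝ :=
  ∑ k ∈ Finset.range (n + 1),
    pochhammer (-(n : ℝ)) k * pochhammer ((n : ℝ) + α + β + 1) k * pochhammer (-x) k /
      (pochhammer (α + 1) k * pochhammer (-(N : ℝ)) k) * (1 / (k.factorial : ℝ))

/-- The Hahn weight `ω(i) = binom(α + i, i) * binom(β + N - i, N - i)` at the nodes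
`i = 0, …, N`; `Ring.choose` is the generalised binomial coefficient with real upper entry. -/
def hahnWeight (α β : ℝ) (N i : ℕ) : ℝ :=
  Ring.choose (α + (i : ℝ)) i * Ring.choose (β + ((N - i : ℕ) : ℝ)) (N - i)

/-- The discrete inner product `⟨g, h⟩_ω = ∑_{i=0}^N g(i) h(i) ω(i)`. -/
def hahnInner (α β : ℝ) (N : ℕ) (g h : ℝ → ℝ) : ℝ :=
  ∑ i ∈ Finset.range (N + 1), g (i : ℝ) * h (i : ℝ) * hahnWeight α β N i

/-- The discrete least squares approximation of degree `n` of `f : [-1, 1] → ℝ` on the nodes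
`-1 + 2 i / N`, as the Hahn expansion
`∑_{k=0}^n ⟨f(2(·)/N - 1), Q_k⟩_ω / ⟨Q_k, Q_k⟩_ω * Q_k(N (1 + x) / 2)`. -/
def hahnExpansion (α β : ℝ) (N n : ℕ) (f : ℝ → ℝ) (x : ℝ) : ℝ :=
  ∑ k ∈ Finset.range (n + 1),
    hahnInner α β N (fun y => f (2 / (N : ℝ) * y - 1)) (hahnQ k α β N) /
      hahnInner α β N (hahnQ k α β N) (hahnQ k α β N) *
      hahnQ k α β N ((N : ℝ) / 2 * (1 + x))

/-- `n(α, N) = 1/2 - α + (1/2) √((2α + 1)(2α + 2N + 1))`. -/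
def degreeBound (α : ℝ) (N : ℕ) : ℝ :=
  1 / 2 - α + 1 / 2 * Real.sqrt ((2 * α + 1) * (2 * α + 2 * (N : ℝ) + 1))

/-- The sup norm `sup_{x ∈ [-1, 1]} |g x|`, used for functions continuous on `[-1, 1]` only. -/
def supNormI (g : ℝ → ℝ) : ℝ :=
  ⨆ x : Set.Icc (-1 : ℝ) 1, |g x|

end

section Interpolation

open Set

/-- The generalised Rolle theorem: a function with `n + 1` zeros has an `n`-th derivative with
a zero. -/
theorem exists_iteratedDerivWithin_eq_zero {a b : ℝ} (hab : a < b) (n : ℕ) (g : ℝ → ℝ)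
    (hg : ContDiffOn ℝ n g (Icc a b)) (s : Finset ℝ) (hs : ↑s ⊆ Icc a b) (hcard : s.card = n + 1)
    (hzero : ∀ x ∈ s, g x = 0) :
    ∃ ξ ∈ Icc a b, iteratedDerivWithin n g (Icc a b) ξ = 0 := by
  induction n generalizing g s with
  | zero =>
    obtain ⟨x, hx⟩ : s.Nonempty := Finset.card_pos.mp (by omega)
    exact ⟨x, hs hx, by simpa using hzero x hx⟩
  | succ n ih =>
    have hu := uniqueDiffOn_Icc hab
    let e := s.orderEmbOfFin hcard
    have hlt (i : Fin (n + 1)) : e i.castSucc < e i.succ := e.strictMono i.castSucc_lt_succ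
    have hmem (i : Fin (n + 2)) : e i ∈ s := s.orderEmbOfFin_mem hcard i
    have key (i : Fin (n + 1)) :
        ∃ c ∈ Ioo (e i.castSucc) (e i.succ), derivWithin g (Icc a b) c = 0 := by
      have hsub : Icc (e i.castSucc) (e i.succ) ⊆ Icc a b :=
        Icc_subset_Icc (hs (hmem _)).1 (hs (hmem _)).2
      obtain ⟨c, hc, h⟩ := exists_deriv_eq_zero (hlt i) (hg.continuousOn.mono hsub)
        (by rw [hzero _ (hmem _), hzero _ (hmem _)])
      refine ⟨c, hc, ?_⟩
      have hnhds : Icc a b ∈ nhds c :=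
        Filter.mem_of_superset (Icc_mem_nhds hc.1 hc.2) hsub
      rwa [derivWithin_of_mem_nhds hnhds]
    choose c hc hc0 using key
    have hmono : StrictMono c := by
      refine Fin.strictMono_iff_lt_succ.mpr fun i => ?_
      refine (hc _).2.trans ?_
      have := (hc i.succ).1
      rwa [← Fin.succ_castSucc] at this
    have hd : ContDiffOn ℝ n (derivWithin g (Icc a b)) (Icc a b) :=
      hg.derivWithin hu (by norm_cast)
    obtain ⟨ξ, hξ, h⟩ := ih (derivWithin g (Icc a b)) hd (Finset.univ.map ⟨c, hmono.injective⟩)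
      (by
        intro x hx
        simp only [Finset.coe_map, Function.Embedding.coeFn_mk, Finset.coe_univ, image_univ,
          mem_range] at hx
        obtain ⟨i, rfl⟩ := hx
        exact ⟨(hs (hmem _)).1.trans (hc i).1.le, (hc i).2.le.trans (hs (hmem _)).2⟩)
      (by simp)
      (by
        intro x hx
        simp only [Finset.mem_map, Finset.mem_univ, true_and, Function.Embedding.coeFn_mk] at hx
        obtain ⟨i, rfl⟩ := hx
        exact hc0 i)
    exact ⟨ξ, hξ, by rwa [iteratedDerivWithin_succ']⟩

theorem iteratedDerivWithin_polynomial_eval {a b : ℝ} (hab : a < b) (p : Polynomial ℝ) (n : ℕ)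
    {x : ℝ} (hx : x ∈ Icc a b) :
    iteratedDerivWithin n (fun t => p.eval t) (Icc a b) x =
      (Polynomial.derivative^[n] p).eval x := by
  induction n generalizing p x with
  | zero => simp
  | succ n ih =>
    rw [iteratedDerivWithin_succ']
    have h : EqOn (derivWithin (fun t => p.eval t) (Icc a b))
        (fun t => (Polynomial.derivative p).eval t) (Icc a b) := fun y hy => by
      rw [p.derivWithin ((uniqueDiffOn_Icc hab) y hy)]
    rw [iteratedDerivWithin_congr h hx, ih _ hx, Function.iterate_succ_apply]

/-- The error of Lagrange interpolation at the points of `s`. -/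
theorem exists_polynomial_abs_sub_le {a b : ℝ} (hab : a < b) (s : Finset ℝ) (hs : ↑s ⊆ Icc a b)
    (f : ℝ → ℝ) (hf : ContDiffOn ℝ s.card f (Icc a b)) {M : ℝ}
    (hM : ∀ x ∈ Icc a b, |iteratedDerivWithin s.card f (Icc a b) x| ≤ M) :
    ∃ p : Polynomial ℝ, p.degree < s.card ∧ ∀ x ∈ Icc a b,
      |f x - p.eval x| ≤ M / (s.card.factorial : ℝ) * ∏ z ∈ s, |x - z| := by
  classical
  let p := Lagrange.interpolate s id f
  have hp : p.degree < s.card := Lagrange.degree_interpolate_lt _ (injOn_id _)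
  have hpe (z : ℝ) (hz : z ∈ s) : p.eval z = f z :=
    Lagrange.eval_interpolate_at_node f (injOn_id _) hz
  refine ⟨p, hp, fun x hx => ?_⟩
  by_cases hxs : x ∈ s
  · rw [hpe x hxs, sub_self, abs_zero, Finset.prod_eq_zero hxs (by simp), mul_zero]
  let W := Lagrange.nodal s (id : ℝ → ℝ)
  have hW (y : ℝ) : W.eval y = ∏ z ∈ s, (y - z) := Lagrange.eval_nodal
  have hWx : W.eval x ≠ 0 := by
    rw [hW]
    exact Finset.prod_ne_zero_iff.mpr fun z hz => sub_ne_zero.mpr fun h => hxs (h ▸ hz)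
  set c : ℝ := (f x - p.eval x) / W.eval x with hc
  let r : Polynomial ℝ := p + Polynomial.C c * W
  have hrc : ContDiff ℝ s.card (fun t => r.eval t) := by
    simpa using r.contDiff_aeval (𝕜 := ℝ) (s.card : WithTop ℕ∞)
  obtain ⟨ξ, hξ, h⟩ := exists_iteratedDerivWithin_eq_zero hab s.card (fun t => f t - r.eval t)
    (hf.sub (hrc.contDiffOn)) (insert x s)
    (by
      rw [Finset.coe_insert]
      exact insert_subset hx hs)
    (Finset.card_insert_of_notMem hxs)
    (by
      intro y hy
      rcases Finset.mem_insert.mp hy with rfl | hy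
      · simp only [r, hc, Polynomial.eval_add, Polynomial.eval_mul, Polynomial.eval_C]
        field_simp
        ring
      · have : W.eval y = 0 := by
          rw [hW]
          exact Finset.prod_eq_zero hy (sub_self y)
        simp [r, hpe y hy, this])
  have hu := uniqueDiffOn_Icc hab
  have hsub : iteratedDerivWithin s.card (fun t => f t - r.eval t) (Icc a b) ξ =
      iteratedDerivWithin s.card f (Icc a b) ξ - (Polynomial.derivative^[s.card] r).eval ξ := by
    rw [← iteratedDerivWithin_polynomial_eval hab r s.card hξ]
    exact iteratedDerivWithin_sub hξ hu (hf ξ hξ) hrc.contDiffWithinAt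
  have hr : (Polynomial.derivative^[s.card] r).eval ξ = c * s.card.factorial := by
    have h1 : Polynomial.derivative^[s.card] p = 0 :=
      Polynomial.iterate_derivative_eq_zero_of_degree_lt hp
    have h2 : Polynomial.derivative^[s.card] W = Polynomial.C (s.card.factorial : ℝ) := by
      have := Polynomial.iterate_derivative_prod_X_sub_C (S := s) le_rfl
      simpa [W, Lagrange.nodal_eq] using this
    simp only [r]
    rw [iterate_map_add, h1, Polynomial.iterate_derivative_C_mul, h2]
    simp
  rw [hsub, hr, sub_eq_zero] at h
  have hfac : (0 : ℝ) < s.card.factorial := by exact_mod_cast s.card.factorial_pos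
  have hbound := hM ξ hξ
  rw [h, abs_mul, abs_of_pos hfac] at hbound
  have hfx : f x - p.eval x = c * W.eval x := by
    rw [hc]
    field_simp
  rw [hfx, abs_mul, hW, Finset.abs_prod]
  gcongr
  rwa [le_div_iff₀ hfac]

end Interpolation

section HahnIdentities

theorem pochhammer_zero_right (a : ℝ) : pochhammer a 0 = 1 := by simp [pochhammer]

theorem pochhammer_succ_right (a : ℝ) (k : ℕ) :
    pochhammer a (k + 1) = pochhammer a k * (a + k) := by
  simp [pochhammer, ascPochhammer_succ_eval]

theorem pochhammer_succ_left (a : ℝ) (k : ℕ) :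
    pochhammer a (k + 1) = a * pochhammer (a + 1) k := by
  simp [pochhammer, ascPochhammer_succ_left]

theorem pochhammer_neg_natCast_of_lt {k j : ℕ} (h : k < j) : pochhammer (-(k : ℝ)) j = 0 :=
  ascPochhammer_eval_neg_coe_nat_of_lt h

theorem pochhammer_pos {a : ℝ} (ha : 0 < a) (k : ℕ) : 0 < pochhammer a k :=
  ascPochhammer_pos k a ha

theorem pochhammer_neg_natCast_ne_zero {N j : ℕ} (h : j ≤ N) : pochhammer (-(N : ℝ)) j ≠ 0 := by
  induction j with
  | zero => simp [pochhammer_zero_right]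
  | succ j ih =>
    rw [pochhammer_succ_right]
    refine mul_ne_zero (ih (by omega)) ?_
    have : (j : ℝ) + 1 ≤ N := by exact_mod_cast h
    linarith

/-- The coefficients of the symmetric Hahn polynomials in the basis `(-x)_j`, with real degree
and real endpoint. -/
noncomputable def hahnCoeff (κ α M : ℝ) (j : ℕ) : ℝ :=
  pochhammer (-κ) j * pochhammer (κ + 2 * α + 1) j /
    (pochhammer (α + 1) j * pochhammer (-M) j * (j.factorial : ℝ))

theorem hahnCoeff_zero (κ α M : ℝ) : hahnCoeff κ α M 0 = 1 := by
  simp [hahnCoeff, pochhammer_zero_right]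

theorem hahnCoeff_succ (κ α M : ℝ) (j : ℕ) :
    hahnCoeff κ α M (j + 1) = hahnCoeff κ α M j *
      ((j - κ) * (κ + 2 * α + 1 + j) / ((α + 1 + j) * (j - M) * (j + 1))) := by
  rw [hahnCoeff, hahnCoeff, div_mul_div_comm]
  simp only [pochhammer_succ_right, Nat.factorial_succ, Nat.cast_mul, Nat.cast_add, Nat.cast_one]
  congr 1 <;> ring

theorem hahnCoeff_natCast_of_lt {k j : ℕ} (h : k < j) (α M : ℝ) : hahnCoeff k α M j = 0 := by
  simp [hahnCoeff, pochhammer_neg_natCast_of_lt h]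

theorem hahnQ_eq_sum (k : ℕ) (α : ℝ) (N : ℕ) (x : ℝ) {m : ℕ} (hm : k + 1 ≤ m) :
    hahnQ k α α N x = ∑ j ∈ Finset.range m, hahnCoeff k α N j * pochhammer (-x) j := by
  rw [hahnQ]
  refine (Finset.sum_congr rfl fun j _ => ?_).trans
    (Finset.sum_subset (Finset.range_mono hm) fun j _ hj => ?_)
  · rw [hahnCoeff, show (k : ℝ) + α + α + 1 = k + 2 * α + 1 by ring]
    simp only [div_eq_mul_inv, mul_inv, one_mul]
    ring
  · rw [hahnCoeff_natCast_of_lt (by simpa using hj), zero_mul]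

/-- The coefficient of the polynomial of degree `κ` in the contiguity relations. -/
noncomputable def contigA (κ α M : ℝ) : ℝ :=
  (κ + 2 * α + 2) * (M - κ - 1) / ((α + 1) * M * (M - 1))

/-- The coefficient of the polynomial of degree `κ - 1` in the contiguity relations. -/
noncomputable def contigB (κ α M : ℝ) : ℝ :=
  κ * (M + κ + 2 * α + 1) / ((α + 1) * M * (M - 1))

theorem hahnCoeff_factors {κ α M : ℝ} (j : ℕ) (hα : -1 < α) (hM0 : M ≠ 0) (hM1 : M ≠ 1)
    (hj : (j : ℝ) + 1 - M ≠ 0) (hD : pochhammer (2 - M) j ≠ 0) :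
    ∃ T : ℝ,
      hahnCoeff κ α M (j + 1) =
        T * ((j - κ) * (κ + 2 * α + 1) * (j + 1 - M) / ((α + 1) * M * (M - 1) * (j + 1))) ∧
      hahnCoeff (κ + 1) α M (j + 1) =
        T * (-((κ + 1) * (κ + 2 * α + 2 + j) * (j + 1 - M)) /
          ((α + 1) * M * (M - 1) * (j + 1))) ∧
      (κ + 2 * α + 2) * hahnCoeff κ (α + 1) (M - 2) j = T * (κ + 2 * α + 2 + j) ∧
      κ * hahnCoeff (κ - 1) (α + 1) (M - 2) j = T * (κ - j) := by
  have hα1 : α + 1 ≠ 0 := by linarith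
  have hM1' : M - 1 ≠ 0 := sub_ne_zero.mpr hM1
  have hE := (pochhammer_pos (show 0 < α + 1 + 1 by linarith) j).ne'
  have hf : (j.factorial : ℝ) ≠ 0 := by exact_mod_cast j.factorial_ne_zero
  have hj1 : (j : ℝ) + 1 ≠ 0 := by positivity
  have hden : pochhammer (-M) (j + 1) = M * (M - 1) * pochhammer (2 - M) j / (j + 1 - M) := by
    rw [eq_div_iff hj]
    have h := pochhammer_succ_right (-M) (j + 1)
    rw [pochhammer_succ_left, pochhammer_succ_left, show -M + 1 + 1 = 2 - M by ring] at h
    push_cast at h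
    linear_combination -h
  have hU : κ * pochhammer (1 - κ) j = (κ - j) * pochhammer (-κ) j := by
    have h := pochhammer_succ_right (-κ) j
    rw [pochhammer_succ_left, show -κ + 1 = 1 - κ by ring] at h
    linear_combination -h
  have hV : (κ + 2 * α + 2) * pochhammer (κ + 2 * α + 3) j =
      pochhammer (κ + 2 * α + 2) j * (κ + 2 * α + 2 + j) := by
    have h := pochhammer_succ_right (κ + 2 * α + 2) j
    rwa [pochhammer_succ_left, show κ + 2 * α + 2 + 1 = κ + 2 * α + 3 by ring] at h
  refine ⟨pochhammer (-κ) j * pochhammer (κ + 2 * α + 2) j /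
    (pochhammer (α + 1 + 1) j * pochhammer (2 - M) j * (j.factorial : ℝ)), ?_, ?_, ?_, ?_⟩
  · rw [hahnCoeff, hden, pochhammer_succ_left (α + 1), pochhammer_succ_right (-κ),
      pochhammer_succ_left (κ + 2 * α + 1), show κ + 2 * α + 1 + 1 = κ + 2 * α + 2 by ring,
      Nat.factorial_succ]
    push_cast
    field_simp
    ring
  · rw [hahnCoeff, hden, pochhammer_succ_left (α + 1), pochhammer_succ_left (-(κ + 1)),
      show -(κ + 1) + 1 = -κ by ring, show κ + 1 + 2 * α + 1 = κ + 2 * α + 2 by ring,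
      pochhammer_succ_right (κ + 2 * α + 2), Nat.factorial_succ]
    push_cast
    field_simp
  · rw [hahnCoeff, show κ + 2 * (α + 1) + 1 = κ + 2 * α + 3 by ring,
      show -(M - 2) = 2 - M by ring]
    field_simp
    linear_combination pochhammer (-κ) j * hV
  · rw [hahnCoeff, show κ - 1 + 2 * (α + 1) + 1 = κ + 2 * α + 2 by ring,
      show -(M - 2) = 2 - M by ring, show -(κ - 1) = 1 - κ by ring]
    field_simp
    linear_combination pochhammer (κ + 2 * α + 2) j * hU

theorem hahnCoeff_sub {κ α M : ℝ} (j : ℕ) (hα : -1 < α) (hM0 : M ≠ 0) (hM1 : M ≠ 1)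
    (hj : (j : ℝ) + 1 - M ≠ 0) (hD : pochhammer (2 - M) j ≠ 0) :
    hahnCoeff κ α M (j + 1) - hahnCoeff (κ + 1) α M (j + 1) =
      -(contigA κ α M * hahnCoeff κ (α + 1) (M - 2) j +
        contigB κ α M * hahnCoeff (κ - 1) (α + 1) (M - 2) j) := by
  obtain ⟨T, h1, h2, h3, h4⟩ := hahnCoeff_factors (κ := κ) j hα hM0 hM1 hj hD
  have hα1 : α + 1 ≠ 0 := by linarith
  have hM1' : M - 1 ≠ 0 := sub_ne_zero.mpr hM1
  have hj1 : (j : ℝ) + 1 ≠ 0 := by positivity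
  rw [h1, h2, contigA, contigB]
  field_simp
  linear_combination ((j : ℝ) + 1) * (M - κ - 1) * h3 + ((j : ℝ) + 1) * (M + κ + 2 * α + 1) * h4

theorem hahnCoeff_add_zero {κ α M : ℝ} (hα : -1 < α) (hM0 : M ≠ 0) (hM1 : M ≠ 1) :
    hahnCoeff κ α M 0 + hahnCoeff (κ + 1) α M 0 -
        (hahnCoeff κ α M 1 + hahnCoeff (κ + 1) α M 1) =
      (M - 1) * (contigA κ α M * hahnCoeff κ (α + 1) (M - 2) 0 -
        contigB κ α M * hahnCoeff (κ - 1) (α + 1) (M - 2) 0) := by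
  have hα1 : α + 1 ≠ 0 := by linarith
  have hM1' : M - 1 ≠ 0 := sub_ne_zero.mpr hM1
  rw [hahnCoeff_succ κ α M 0, hahnCoeff_succ (κ + 1) α M 0]
  simp only [hahnCoeff_zero, contigA, contigB]
  push_cast
  simp only [zero_sub, add_zero, zero_add]
  field_simp
  ring

theorem hahnCoeff_add_succ {κ α M : ℝ} (j : ℕ) (hα : -1 < α) (hM0 : M ≠ 0) (hM1 : M ≠ 1)
    (hj : (j : ℝ) + 1 - M ≠ 0) (hD : pochhammer (2 - M) j ≠ 0)
    (htop : (j : ℝ) + 2 = M → κ = j) :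
    hahnCoeff κ α M (j + 1) + hahnCoeff (κ + 1) α M (j + 1) -
        (j + 2) * (hahnCoeff κ α M (j + 1 + 1) + hahnCoeff (κ + 1) α M (j + 1 + 1)) =
      (contigA κ α M * hahnCoeff κ (α + 1) (M - 2) j -
        contigB κ α M * hahnCoeff (κ - 1) (α + 1) (M - 2) j) +
      (M - j - 2) * (contigA κ α M * hahnCoeff κ (α + 1) (M - 2) (j + 1) -
        contigB κ α M * hahnCoeff (κ - 1) (α + 1) (M - 2) (j + 1)) := by
  obtain ⟨T, h1, h2, h3, h4⟩ := hahnCoeff_factors (κ := κ) j hα hM0 hM1 hj hD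
  have hα1 : α + 1 ≠ 0 := by linarith
  have hj0 : (0 : ℝ) ≤ j := j.cast_nonneg
  have hα2 : α + 2 + j ≠ 0 := by linarith
  have hM1' : M - 1 ≠ 0 := sub_ne_zero.mpr hM1
  have hj1 : (j : ℝ) + 1 ≠ 0 := by positivity
  have hj2 : (j : ℝ) + 2 ≠ 0 := by positivity
  have e1 : contigA κ α M * hahnCoeff κ (α + 1) (M - 2) j =
      T * (κ + 2 * α + 2 + j) * (M - κ - 1) / ((α + 1) * M * (M - 1)) := by
    rw [contigA, ← h3]
    ring
  have e2 : contigB κ α M * hahnCoeff (κ - 1) (α + 1) (M - 2) j =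
      T * (κ - j) * (M + κ + 2 * α + 1) / ((α + 1) * M * (M - 1)) := by
    rw [contigB, ← h4]
    ring
  have e3 : (M - j - 2) * (contigA κ α M * hahnCoeff κ (α + 1) (M - 2) (j + 1)) =
      T * (κ + 2 * α + 2 + j) * (M - κ - 1) / ((α + 1) * M * (M - 1)) *
        ((κ - j) * (κ + 2 * α + 3 + j) / ((α + 2 + j) * (j + 1))) := by
    by_cases hM : (j : ℝ) + 2 = M
    · have := htop hM
      rw [← hM, ← this]
      ring
    · have hM2 : (j : ℝ) - (M - 2) ≠ 0 := fun h => hM (by linarith)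
      have : M - j - 2 = -((j : ℝ) - (M - 2)) := by ring
      rw [hahnCoeff_succ, ← mul_assoc (contigA _ _ _), e1, this,
        show α + 1 + 1 + (j : ℝ) = α + 2 + j by ring]
      field_simp
      ring
  have e4 : (M - j - 2) * (contigB κ α M * hahnCoeff (κ - 1) (α + 1) (M - 2) (j + 1)) =
      T * (κ - j) * (M + κ + 2 * α + 1) / ((α + 1) * M * (M - 1)) *
        ((κ - 1 - j) * (κ + 2 * α + 2 + j) / ((α + 2 + j) * (j + 1))) := by
    by_cases hM : (j : ℝ) + 2 = M
    · have := htop hM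
      rw [← hM, ← this]
      ring
    · have hM2 : (j : ℝ) - (M - 2) ≠ 0 := fun h => hM (by linarith)
      have : M - j - 2 = -((j : ℝ) - (M - 2)) := by ring
      rw [hahnCoeff_succ, ← mul_assoc (contigB _ _ _), e2, this,
        show α + 1 + 1 + (j : ℝ) = α + 2 + j by ring]
      field_simp
      ring
  rw [mul_sub, e1, e2, e3, e4, hahnCoeff_succ _ _ _ (j + 1), hahnCoeff_succ _ _ _ (j + 1), h1, h2]
  push_cast
  rw [show α + 1 + ((j : ℝ) + 1) = α + 2 + j by ring]
  rw [show (j : ℝ) + 1 + 1 = j + 2 by ring]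
  field_simp
  ring

/-- The shifted Hahn polynomials `Q_k(x - 1; α + 1, α + 1, N - 2)`, as a series with an arbitrary
real degree. -/
noncomputable def hahnShift (κ α M : ℝ) (m : ℕ) (x : ℝ) : ℝ :=
  ∑ j ∈ Finset.range m, hahnCoeff κ (α + 1) (M - 2) j * pochhammer (1 - x) j

theorem hahnShift_succ_top (k : ℕ) (α M x : ℝ) :
    hahnShift k α M (k + 1 + 1) x = hahnShift k α M (k + 1) x := by
  rw [hahnShift, Finset.sum_range_succ, hahnCoeff_natCast_of_lt (Nat.lt_succ_self k), zero_mul,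
    add_zero, hahnShift]

theorem pochhammer_two_sub_ne_zero {N j : ℕ} (h : j + 2 ≤ N) :
    pochhammer (2 - (N : ℝ)) j ≠ 0 := by
  obtain ⟨m, rfl⟩ := Nat.exists_eq_add_of_le' (show 2 ≤ N by omega)
  rw [show (2 : ℝ) - ((m + 2 : ℕ) : ℝ) = -(m : ℝ) by push_cast; ring]
  exact pochhammer_neg_natCast_ne_zero (by omega)

theorem hahnQ_sub_succ {α : ℝ} (hα : -1 < α) {k N : ℕ} (hk : k + 2 ≤ N) (x : ℝ) :
    hahnQ k α α N x - hahnQ (k + 1) α α N x =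
      x * (contigA k α N * hahnShift k α N (k + 1) x +
        contigB k α N * hahnShift (k - 1) α N (k + 1) x) := by
  have hN : (k : ℝ) + 2 ≤ N := by exact_mod_cast hk
  have hk0 : (0 : ℝ) ≤ k := k.cast_nonneg
  rw [hahnQ_eq_sum k α N x (m := k + 1 + 1) (by omega),
    hahnQ_eq_sum (k + 1) α N x (m := k + 1 + 1) le_rfl, ← Finset.sum_sub_distrib,
    Finset.sum_range_succ']
  simp only [hahnCoeff_zero, sub_self, add_zero]
  rw [hahnShift, hahnShift, Finset.mul_sum, Finset.mul_sum, ← Finset.sum_add_distrib,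
    Finset.mul_sum]
  refine Finset.sum_congr rfl fun j hj => ?_
  have hj' : j ≤ k := by simpa [Nat.lt_succ_iff] using hj
  have hjk : (j : ℝ) ≤ k := by exact_mod_cast hj'
  have h := hahnCoeff_sub (κ := k) (M := N) j hα (by linarith) (by linarith) (by linarith)
    (pochhammer_two_sub_ne_zero (by omega))
  rw [pochhammer_succ_left, show -x + 1 = 1 - x by ring]
  push_cast
  linear_combination (-x * pochhammer (1 - x) j) * h

theorem hahnQ_add_succ {α : ℝ} (hα : -1 < α) {k N : ℕ} (hk : k + 2 ≤ N) (x : ℝ) :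
    hahnQ k α α N x + hahnQ (k + 1) α α N x =
      (N - x) * (contigA k α N * hahnShift k α N (k + 1) x -
        contigB k α N * hahnShift (k - 1) α N (k + 1) x) := by
  have hN : (k : ℝ) + 2 ≤ N := by exact_mod_cast hk
  have hk0 : (0 : ℝ) ≤ k := k.cast_nonneg
  set c : ℕ → ℝ := fun j => hahnCoeff k α N j + hahnCoeff (k + 1) α N j with hc
  set e : ℕ → ℝ := fun j => contigA k α N * hahnCoeff k (α + 1) (N - 2) j -
    contigB k α N * hahnCoeff (k - 1) (α + 1) (N - 2) j with he
  have hctop : c (k + 1 + 1) = 0 := by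
    have := hahnCoeff_natCast_of_lt (Nat.lt_succ_self (k + 1)) α N
    push_cast at this
    simp only [hc, hahnCoeff_natCast_of_lt (show k < k + 1 + 1 by omega) α N, this, add_zero]
  have hetop : e (k + 1) = 0 := by
    simp only [he]
    rw [hahnCoeff_natCast_of_lt (Nat.lt_succ_self k), mul_zero, zero_sub, neg_eq_zero]
    rcases Nat.eq_zero_or_pos k with rfl | hpos
    · simp [contigB]
    · have := hahnCoeff_natCast_of_lt (show k - 1 < k + 1 by omega) (α + 1) ((N : ℝ) - 2)
      rw [Nat.cast_pred hpos] at this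
      rw [this, mul_zero]
  have hlhs : hahnQ k α α N x + hahnQ (k + 1) α α N x =
      ∑ j ∈ Finset.range (k + 1 + 1), (c j - (j + 1) * c (j + 1)) * pochhammer (1 - x) j := by
    rw [hahnQ_eq_sum k α N x (m := k + 1 + 1) (by omega),
      hahnQ_eq_sum (k + 1) α N x (m := k + 1 + 1) le_rfl, ← Finset.sum_add_distrib]
    simp only [sub_mul, Finset.sum_sub_distrib]
    rw [Finset.sum_range_succ (fun j : ℕ => ((j : ℝ) + 1) * c (j + 1) * _), hctop,
      Finset.sum_range_succ', Finset.sum_range_succ' (fun j : ℕ => c j * _), mul_zero, zero_mul,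
      add_zero, add_sub_right_comm, ← Finset.sum_sub_distrib]
    congr 1
    · refine Finset.sum_congr rfl fun j _ => ?_
      have h : pochhammer (-x) (j + 1) =
          pochhammer (1 - x) (j + 1) - (j + 1) * pochhammer (1 - x) j := by
        rw [pochhammer_succ_left, show -x + 1 = 1 - x by ring, pochhammer_succ_right]
        ring
      rw [h]
      simp only [hc]
      push_cast
      ring
    · simp only [hc, pochhammer_zero_right]
      push_cast
      ring
  have hrhs : (N - x) * (contigA k α N * hahnShift k α N (k + 1) x -
        contigB k α N * hahnShift (k - 1) α N (k + 1) x) =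
      ∑ j ∈ Finset.range (k + 1 + 1), (N - j - 1) * e j * pochhammer (1 - x) j +
        ∑ j ∈ Finset.range (k + 1), e j * pochhammer (1 - x) (j + 1) := by
    rw [Finset.sum_range_succ _ (k + 1), hetop, mul_zero, zero_mul, add_zero,
      ← Finset.sum_add_distrib, hahnShift, hahnShift, Finset.mul_sum, Finset.mul_sum,
      ← Finset.sum_sub_distrib, Finset.mul_sum]
    refine Finset.sum_congr rfl fun j _ => ?_
    rw [pochhammer_succ_right]
    simp only [he]
    ring
  rw [hlhs, hrhs, Finset.sum_range_succ', Finset.sum_range_succ' (fun j : ℕ => (_ - (j : ℝ) - 1) *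
    e j * _), add_right_comm, ← Finset.sum_add_distrib]
  congr 1
  · refine Finset.sum_congr rfl fun j hj => ?_
    have hj' : j ≤ k := by simpa [Nat.lt_succ_iff] using hj
    have hjk : (j : ℝ) ≤ k := by exact_mod_cast hj'
    have h := hahnCoeff_add_succ (κ := k) (M := N) j hα (by linarith) (by linarith) (by linarith)
      (pochhammer_two_sub_ne_zero (by omega)) (fun h => by linarith)
    simp only [hc, he]
    push_cast
    linear_combination (pochhammer (1 - x) (j + 1)) * h
  · have h := hahnCoeff_add_zero (κ := k) (M := N) hα (by linarith) (by linarith)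
    simp only [hc, he, pochhammer_zero_right]
    push_cast
    linear_combination h

theorem hahnQ_sq_add_le_one {α : ℝ} (hα : -(1 / 2 : ℝ) < α) {N : ℕ} {x : ℝ}
    (hx : x ∈ Set.Icc (0 : ℝ) N) (m : ℕ) (hm : m + 2 ≤ N)
    (hdeg : 2 * (m : ℝ) * (m + 2 * α + 1) ≤ N * (2 * α + 1)) :
    hahnQ (m + 1) α α N x ^ 2 +
      x * (N - x) * (contigA m α N * hahnShift m α N (m + 1) x) ^ 2 ≤ 1 := by
  have hα1 : -1 < α := by linarith
  have key (k : ℕ) (hk : k + 2 ≤ N) :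
      hahnQ (k + 1) α α N x ^ 2 +
        x * (N - x) * (contigA k α N * hahnShift k α N (k + 1) x) ^ 2 =
      hahnQ k α α N x ^ 2 +
        x * (N - x) * (contigB k α N * hahnShift (k - 1) α N (k + 1) x) ^ 2 := by
    have h1 := hahnQ_sub_succ hα1 hk x
    have h2 := hahnQ_add_succ hα1 hk x
    have h3 := congrArg₂ (· * ·) h1 h2
    linear_combination -h3
  have hX : 0 ≤ x * (N - x) := mul_nonneg hx.1 (sub_nonneg.mpr hx.2)
  induction m with
  | zero =>
    rw [key 0 hm]
    simp [contigB, hahnQ, pochhammer_zero_right]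
  | succ m ih =>
    have hm0 : (0 : ℝ) ≤ m := m.cast_nonneg
    have hN : (m : ℝ) + 3 ≤ N := by exact_mod_cast hm
    push_cast at hdeg
    refine le_trans ?_ (ih (by omega) (by nlinarith))
    rw [key _ hm]
    push_cast
    rw [add_sub_cancel_right, hahnShift_succ_top, mul_pow, mul_pow]
    have hden : 0 < (α + 1) * N * (N - 1) := by
      have : (0 : ℝ) < α + 1 := by linarith
      have : (0 : ℝ) < N := by linarith
      have : (0 : ℝ) < (N : ℝ) - 1 := by linarith
      positivity
    have hb : 0 ≤ contigB (m + 1) α N :=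
      div_nonneg (mul_nonneg (by linarith) (by linarith)) hden.le
    have hab : contigB (m + 1) α N ≤ contigA m α N := by
      refine div_le_div_of_nonneg_right ?_ hden.le
      nlinarith
    gcongr

theorem abs_hahnQ_le_one {α : ℝ} (hα : -(1 / 2 : ℝ) < α) {N : ℕ} {x : ℝ}
    (hx : x ∈ Set.Icc (0 : ℝ) N) (m : ℕ) (hm : m + 2 ≤ N)
    (hdeg : 2 * (m : ℝ) * (m + 2 * α + 1) ≤ N * (2 * α + 1)) :
    |hahnQ (m + 1) α α N x| ≤ 1 := by
  have h := hahnQ_sq_add_le_one hα hx m hm hdeg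
  have hX : 0 ≤ x * (N - x) := mul_nonneg hx.1 (sub_nonneg.mpr hx.2)
  rw [← sq_le_one_iff_abs_le_one]
  nlinarith [mul_nonneg hX (sq_nonneg (contigA m α N * hahnShift m α N (m + 1) x))]

end HahnIdentities

section HahnOrthogonality

/-- The second order difference operator with the symmetric Hahn polynomials as eigenfunctions. -/
noncomputable def hahnOperator (α M : ℝ) (y : ℝ → ℝ) (x : ℝ) : ℝ :=
  (x + α + 1) * (x - M) * (y (x + 1) - y x) + x * (x - α - M - 1) * (y (x - 1) - y x)

theorem hahnOperator_pochhammer_zero (α M x : ℝ) :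
    hahnOperator α M (fun x => pochhammer (-x) 0) x = 0 := by
  simp [hahnOperator, pochhammer_zero_right]

theorem hahnOperator_pochhammer_succ (α M x : ℝ) (j : ℕ) :
    hahnOperator α M (fun x => pochhammer (-x) (j + 1)) x =
      (j + 1) * (j + 2 * α + 2) * pochhammer (-x) (j + 1) -
        (j + 1) * (α + j + 1) * (j - M) * pochhammer (-x) j := by
  have h1 : pochhammer (-(x + 1)) (j + 1) = -(x + 1) * pochhammer (-x) j := by
    rw [pochhammer_succ_left, show -(x + 1) + 1 = -x by ring]
  have h2 : pochhammer (-x) (j + 1) = pochhammer (-x) j * (-x + j) := pochhammer_succ_right _ _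
  have h3 : x * pochhammer (-(x - 1)) (j + 1) = -(pochhammer (-x) (j + 1)) * (1 - x + j) := by
    rw [show -(x - 1) = 1 - x by ring, pochhammer_succ_right (1 - x), pochhammer_succ_left (-x),
      show -x + 1 = 1 - x by ring]
    ring
  simp only [hahnOperator]
  rw [h1]
  linear_combination (x - α - M - 1) * h3 -
    ((x + α + 1) * (x - M) + x * (x - α - M - 1) + (x - α - M - 1) * (1 - x + j) +
      (j + 1) * (j + 2 * α + 2)) * h2

theorem hahnOperator_hahnQ {α : ℝ} (hα : -1 < α) {k N : ℕ} (hk : k ≤ N) (x : ℝ) :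
    hahnOperator α N (hahnQ k α α N) x = k * (k + 2 * α + 1) * hahnQ k α α N x := by
  have hQ : hahnQ k α α N = fun x =>
      ∑ j ∈ Finset.range (k + 1), hahnCoeff k α N j * pochhammer (-x) j :=
    funext fun x => hahnQ_eq_sum k α N x le_rfl
  have hlin : hahnOperator α N (hahnQ k α α N) x = ∑ j ∈ Finset.range (k + 1),
      hahnCoeff k α N j * hahnOperator α N (fun x => pochhammer (-x) j) x := by
    rw [hQ]
    simp only [hahnOperator, ← Finset.sum_sub_distrib, Finset.mul_sum, ← Finset.sum_add_distrib]
    refine Finset.sum_congr rfl fun j _ => ?_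
    ring
  rw [hlin, Finset.sum_range_succ', hahnOperator_pochhammer_zero, mul_zero, add_zero, hQ]
  simp only [hahnOperator_pochhammer_succ, mul_sub (hahnCoeff _ _ _ _), Finset.sum_sub_distrib]
  have hstep (j : ℕ) (hj : j ∈ Finset.range k) :
      hahnCoeff k α N (j + 1) * ((j + 1) * (α + j + 1) * (j - N) * pochhammer (-x) j) =
      (j - k) * (k + 2 * α + 1 + j) * (hahnCoeff k α N j * pochhammer (-x) j) := by
    have hj' : (j : ℝ) + 1 ≤ k := by exact_mod_cast Finset.mem_range.mp hj
    have hk' : (k : ℝ) ≤ N := by exact_mod_cast hk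
    have hj0 : (0 : ℝ) ≤ j := j.cast_nonneg
    have h1 : α + 1 + j ≠ 0 := by linarith
    have h2 : (j : ℝ) - N ≠ 0 := by linarith
    have h3 : (j : ℝ) + 1 ≠ 0 := by linarith
    rw [hahnCoeff_succ]
    field_simp
    ring
  rw [Finset.sum_congr rfl hstep]
  have hext : ∑ j ∈ Finset.range k,
      ((j : ℝ) - k) * (k + 2 * α + 1 + j) * (hahnCoeff k α N j * pochhammer (-x) j) =
      ∑ j ∈ Finset.range (k + 1),
        ((j : ℝ) - k) * (k + 2 * α + 1 + j) * (hahnCoeff k α N j * pochhammer (-x) j) := by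
    rw [Finset.sum_range_succ]
    simp
  have hext' : ∑ j ∈ Finset.range k,
      hahnCoeff k α N (j + 1) * ((j + 1) * (j + 2 * α + 2) * pochhammer (-x) (j + 1)) =
      ∑ j ∈ Finset.range (k + 1),
        (j : ℝ) * (j + 2 * α + 1) * (hahnCoeff k α N j * pochhammer (-x) j) := by
    rw [Finset.sum_range_succ']
    simp only [Nat.cast_zero, zero_mul, add_zero]
    refine Finset.sum_congr rfl fun j _ => ?_
    push_cast
    ring
  rw [hext, hext', ← Finset.sum_sub_distrib, Finset.mul_sum]
  refine Finset.sum_congr rfl fun j _ => ?_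
  ring

theorem ringChoose_add_self (α : ℝ) (i : ℕ) :
    Ring.choose (α + i) i = pochhammer (α + 1) i / (i.factorial : ℝ) := by
  have hf : (i.factorial : ℝ) ≠ 0 := by exact_mod_cast i.factorial_ne_zero
  rw [eq_div_iff hf, Ring.choose, show α + (i : ℝ) - i + 1 = α + 1 by ring, mul_comm]
  have h := Ring.factorial_nsmul_multichoose_eq_ascPochhammer (α + 1) i
  rwa [nsmul_eq_mul, Polynomial.ascPochhammer_smeval_eq_eval] at h

theorem hahnWeight_pos {α : ℝ} (hα : -1 < α) (N i : ℕ) : 0 < hahnWeight α α N i := by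
  have h (j : ℕ) : 0 < Ring.choose (α + (j : ℝ)) j := by
    rw [ringChoose_add_self]
    exact div_pos (pochhammer_pos (by linarith) j) (by exact_mod_cast j.factorial_pos)
  exact mul_pos (h _) (h _)

theorem hahnWeight_balance (α : ℝ) {N i : ℕ} (hi : i < N) :
    hahnWeight α α N i * ((i + α + 1) * (i - N)) =
      hahnWeight α α N (i + 1) * ((i + 1) * (i - α - N)) := by
  obtain ⟨m, rfl⟩ := Nat.exists_eq_add_of_lt hi
  rw [hahnWeight, hahnWeight, show i + m + 1 - i = m + 1 by omega,
    show i + m + 1 - (i + 1) = m by omega]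
  simp only [ringChoose_add_self, pochhammer_succ_right, Nat.factorial_succ]
  have h1 : (i.factorial : ℝ) ≠ 0 := by exact_mod_cast i.factorial_ne_zero
  have h2 : (m.factorial : ℝ) ≠ 0 := by exact_mod_cast m.factorial_ne_zero
  have h3 : (i : ℝ) + 1 ≠ 0 := by positivity
  have h4 : (m : ℝ) + 1 ≠ 0 := by positivity
  push_cast
  field_simp
  ring

theorem hahnInner_hahnOperator (α : ℝ) (N : ℕ) (y z : ℝ → ℝ) :
    hahnInner α α N (hahnOperator α N y) z =
      -∑ i ∈ Finset.range N, hahnWeight α α N i * ((i + α + 1) * (i - N)) *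
        ((y (i + 1) - y i) * (z (i + 1) - z i)) := by
  have hsplit : hahnInner α α N (hahnOperator α N y) z =
      (∑ i ∈ Finset.range (N + 1),
        hahnWeight α α N i * ((i + α + 1) * (i - N)) * ((y (i + 1) - y i) * z i)) +
      ∑ i ∈ Finset.range (N + 1),
        hahnWeight α α N i * (i * (i - α - N - 1)) * ((y (i - 1) - y i) * z i) := by
    rw [hahnInner, ← Finset.sum_add_distrib]
    refine Finset.sum_congr rfl fun i _ => ?_
    simp only [hahnOperator]
    ring
  rw [hsplit, Finset.sum_range_succ, Finset.sum_range_succ' _ N]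
  simp only [sub_self, mul_zero, zero_mul, add_zero, Nat.cast_zero]
  rw [← Finset.sum_add_distrib, ← Finset.sum_neg_distrib]
  refine Finset.sum_congr rfl fun i hi => ?_
  have h := hahnWeight_balance α (Finset.mem_range.mp hi)
  push_cast
  rw [add_sub_cancel_right]
  linear_combination (-(y i - y (i + 1)) * z (i + 1)) * h

theorem hahnInner_comm (α β : ℝ) (N : ℕ) (y z : ℝ → ℝ) :
    hahnInner α β N y z = hahnInner α β N z y := by
  simp only [hahnInner, mul_comm (y _)]

theorem hahnInner_hahnQ_of_ne {α : ℝ} (hα : -(1 / 2 : ℝ) < α) {j k N : ℕ} (hj : j ≤ N)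
    (hk : k ≤ N) (hjk : j ≠ k) : hahnInner α α N (hahnQ j α α N) (hahnQ k α α N) = 0 := by
  have h1 : hahnInner α α N (hahnOperator α N (hahnQ j α α N)) (hahnQ k α α N) =
      hahnInner α α N (hahnOperator α N (hahnQ k α α N)) (hahnQ j α α N) := by
    simp only [hahnInner_hahnOperator, mul_comm (hahnQ j α α N (_ + 1) - _)]
  have h2 (a b : ℕ) (ha : a ≤ N) :
      hahnInner α α N (hahnOperator α N (hahnQ a α α N)) (hahnQ b α α N) =
        a * (a + 2 * α + 1) * hahnInner α α N (hahnQ a α α N) (hahnQ b α α N) := by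
    simp only [hahnInner, hahnOperator_hahnQ (by linarith : -1 < α) ha, Finset.mul_sum]
    refine Finset.sum_congr rfl fun i _ => ?_
    ring
  rw [h2 j k hj, h2 k j hk, hahnInner_comm α α N (hahnQ k α α N)] at h1
  have h3 : ((j : ℝ) - k) * (j + k + 2 * α + 1) *
      hahnInner α α N (hahnQ j α α N) (hahnQ k α α N) = 0 := by
    linear_combination h1
  have h4 : (j : ℝ) - k ≠ 0 := sub_ne_zero.mpr (by exact_mod_cast hjk)
  have h5 : (j : ℝ) + k + 2 * α + 1 ≠ 0 := by
    have : (0 : ℝ) ≤ j := j.cast_nonneg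
    have : (0 : ℝ) ≤ k := k.cast_nonneg
    linarith
  simpa [h4, h5] using h3

open Polynomial in
/-- The symmetric Hahn polynomials as polynomials. -/
noncomputable def hahnPoly (k : ℕ) (α : ℝ) (N : ℕ) : ℝ[X] :=
  ∑ j ∈ Finset.range (k + 1), C (hahnCoeff k α N j) * (ascPochhammer ℝ j).comp (-X)

theorem eval_hahnPoly (k : ℕ) (α : ℝ) (N : ℕ) (x : ℝ) :
    (hahnPoly k α N).eval x = hahnQ k α α N x := by
  rw [hahnQ_eq_sum k α N x le_rfl, hahnPoly, Polynomial.eval_finsetSum]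
  simp [pochhammer]

theorem natDegree_hahnPoly_le (k : ℕ) (α : ℝ) (N : ℕ) : (hahnPoly k α N).natDegree ≤ k := by
  refine Polynomial.natDegree_sum_le_of_forall_le _ _ fun j hj => ?_
  refine (Polynomial.natDegree_C_mul_le _ _).trans ?_
  rw [Polynomial.natDegree_comp, ascPochhammer_natDegree]
  have := Finset.mem_range.mp hj
  simp
  omega

theorem coeff_hahnPoly (k : ℕ) (α : ℝ) (N : ℕ) :
    (hahnPoly k α N).coeff k = (-1) ^ k * hahnCoeff k α N k := by
  have hdeg (j : ℕ) : ((ascPochhammer ℝ j).comp (-Polynomial.X)).natDegree = j := by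
    rw [Polynomial.natDegree_comp, ascPochhammer_natDegree]
    simp
  rw [hahnPoly, Polynomial.finsetSum_coeff, Finset.sum_range_succ, Finset.sum_eq_zero, zero_add,
    Polynomial.coeff_C_mul, mul_comm]
  · congr 1
    have h : ((ascPochhammer ℝ k).comp (-Polynomial.X)).leadingCoeff = (-1) ^ k := by
      rw [Polynomial.leadingCoeff_comp (by simp), (monic_ascPochhammer ℝ k).leadingCoeff,
        ascPochhammer_natDegree]
      simp
    rwa [Polynomial.leadingCoeff, hdeg] at h
  · intro j hj
    rw [Polynomial.coeff_C_mul, Polynomial.coeff_eq_zero_of_natDegree_lt, mul_zero]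
    rw [hdeg]
    exact Finset.mem_range.mp hj

theorem hahnCoeff_self (k : ℕ) (α : ℝ) (N : ℕ) :
    hahnCoeff k α N k = (-1) ^ k * pochhammer (k + 2 * α + 1) k /
      (pochhammer (α + 1) k * pochhammer (-(N : ℝ)) k) := by
  have h : pochhammer (-(k : ℝ)) k = (-1) ^ k * (k.factorial : ℝ) := by
    have := ascPochhammer_eval_neg_eq_descPochhammer ℝ (k : ℝ) k
    rw [pochhammer, this, descPochhammer_eval_eq_descFactorial, Nat.descFactorial_self]
  have hf : (k.factorial : ℝ) ≠ 0 := by exact_mod_cast k.factorial_ne_zero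
  rw [hahnCoeff, h]
  field_simp

theorem hahnCoeff_self_ne_zero {k N : ℕ} (hk : k ≤ N) {α : ℝ} (hα : -(1 / 2 : ℝ) < α) :
    hahnCoeff k α N k ≠ 0 := by
  rw [hahnCoeff_self]
  have h0 : (0 : ℝ) ≤ k := k.cast_nonneg
  have h1 := (pochhammer_pos (show 0 < (k : ℝ) + 2 * α + 1 by linarith) k).ne'
  have h2 := (pochhammer_pos (show 0 < α + 1 by linarith) k).ne'
  have h3 := pochhammer_neg_natCast_ne_zero hk
  simp [h1, h2, h3]

theorem inv_abs_hahnCoeff_self_le {k N : ℕ} {α : ℝ} (hα : -(1 / 2 : ℝ) < α) :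
    |hahnCoeff k α N k|⁻¹ ≤
      N ^ k * pochhammer (α + 1) k / pochhammer (k + 2 * α + 1) k := by
  have h0 : (0 : ℝ) ≤ k := k.cast_nonneg
  have h1 := pochhammer_pos (show 0 < (k : ℝ) + 2 * α + 1 by linarith) k
  have h2 := pochhammer_pos (show 0 < α + 1 by linarith) k
  have h3 : |pochhammer (-(N : ℝ)) k| ≤ N ^ k := by
    have := ascPochhammer_eval_neg_eq_descPochhammer ℝ (N : ℝ) k
    rw [pochhammer, this, descPochhammer_eval_eq_descFactorial, abs_mul, abs_pow, abs_neg, abs_one,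
      one_pow, one_mul, Nat.abs_cast]
    exact_mod_cast Nat.descFactorial_le_pow N k
  rw [hahnCoeff_self, abs_div, abs_mul, abs_mul, abs_pow, abs_neg, abs_one, one_pow, one_mul,
    abs_of_pos h1, abs_of_pos h2, inv_div, mul_comm (pochhammer (α + 1) k)]
  gcongr

end HahnOrthogonality

section DiscreteOrthogonality

open Polynomial

/-- Every nonzero polynomial becomes of constant sign on `[a, b]` after multiplication with the
linear factors at finitely many of its zeros in `(a, b)`. -/
theorem exists_finset_sign_mul_prod {a b : ℝ} (p : ℝ[X]) (hp : p ≠ 0) :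
    ∃ Z : Finset ℝ, ↑Z ⊆ Set.Ioo a b ∧ (∏ z ∈ Z, (X - C z)) ∣ p ∧
      ((∀ x ∈ Set.Icc a b, 0 ≤ (p * ∏ z ∈ Z, (X - C z)).eval x) ∨
        ∀ x ∈ Set.Icc a b, (p * ∏ z ∈ Z, (X - C z)).eval x ≤ 0) := by
  classical
  induction hd : p.natDegree using Nat.strong_induction_on generalizing p with
  | _ d ih =>
    by_cases hroot : ∃ z ∈ Set.Ioo a b, p.eval z = 0
    · obtain ⟨z, hz, hz0⟩ := hroot
      obtain ⟨p₁, rfl⟩ := dvd_iff_isRoot.mpr hz0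
      have hp₁ : p₁ ≠ 0 := right_ne_zero_of_mul hp
      have hdeg : p₁.natDegree < d := by
        rw [natDegree_mul (X_sub_C_ne_zero z) hp₁, natDegree_X_sub_C] at hd
        omega
      obtain ⟨Z, hZ, hdvd, hsign⟩ := ih _ hdeg p₁ hp₁ rfl
      by_cases hzZ : z ∈ Z
      · refine ⟨Z.erase z, fun y hy => hZ (Finset.mem_of_mem_erase hy), ?_, ?_⟩
        · exact ((Finset.prod_dvd_prod_of_subset _ _ _ (Z.erase_subset z)).trans hdvd).mul_left _
        · have : (X - C z) * p₁ * ∏ z ∈ Z.erase z, (X - C z) = p₁ * ∏ z ∈ Z, (X - C z) := by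
            rw [← Finset.mul_prod_erase Z _ hzZ]
            ring
          rwa [this]
      · refine ⟨insert z Z, ?_, ?_, ?_⟩
        · rw [Finset.coe_insert]
          exact Set.insert_subset hz hZ
        · rw [Finset.prod_insert hzZ]
          exact mul_dvd_mul_left _ hdvd
        · rw [Finset.prod_insert hzZ]
          have (x : ℝ) : ((X - C z) * p₁ * ((X - C z) * ∏ z ∈ Z, (X - C z))).eval x =
              (x - z) ^ 2 * (p₁ * ∏ z ∈ Z, (X - C z)).eval x := by
            simp only [eval_mul, eval_sub, eval_X, eval_C]
            ring
          simp only [this]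
          exact hsign.imp (fun h x hx => mul_nonneg (sq_nonneg _) (h x hx))
            fun h x hx => mul_nonpos_of_nonneg_of_nonpos (sq_nonneg _) (h x hx)
    · push Not at hroot
      refine ⟨∅, by simp, by simp, ?_⟩
      simp only [Finset.prod_empty, mul_one]
      by_contra! hcon
      obtain ⟨⟨x, hx, hx0⟩, y, hy, hy0⟩ := hcon
      have hcont : ContinuousOn (fun t => p.eval t) (Set.uIcc x y) := p.continuous.continuousOn
      obtain ⟨c, hc, hc0⟩ := intermediate_value_uIcc hcont (show (0 : ℝ) ∈ Set.uIcc _ _ from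
        Set.mem_uIcc.mpr (Or.inl ⟨hx0.le, hy0.le⟩))
      have hcx : c ≠ x := by rintro rfl; exact hx0.ne hc0
      have hcy : c ≠ y := by rintro rfl; exact hy0.ne' hc0
      refine hroot c ?_ hc0
      rcases Set.mem_uIcc.mp hc with h | h
      · exact ⟨hx.1.trans_lt (lt_of_le_of_ne h.1 hcx.symm), (lt_of_le_of_ne h.2 hcy).trans_le hy.2⟩
      · exact ⟨hy.1.trans_lt (lt_of_le_of_ne h.1 hcy.symm), (lt_of_le_of_ne h.2 hcx).trans_le hx.2⟩

/-- The zeros of a polynomial of degree `n` orthogonal to all polynomials of degree less than `n`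
with respect to a nonnegative measure on `{0, …, N}` with more than `n` atoms are simple and lie in
`(0, N)`. -/
theorem exists_finset_zeros_of_orthogonal {N n : ℕ} (w : ℕ → ℝ)
    (hw : ∀ i ∈ Finset.range (N + 1), 0 ≤ w i) (S : Finset ℕ) (hS : S ⊆ Finset.range (N + 1))
    (hcard : n < S.card) (hwS : ∀ i ∈ S, 0 < w i) (p : ℝ[X]) (hp : p ≠ 0) (hdeg : p.natDegree ≤ n)
    (horth : ∀ r : ℝ[X], r.degree < n →
      ∑ i ∈ Finset.range (N + 1), w i * p.eval (i : ℝ) * r.eval (i : ℝ) = 0) :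
    ∃ (c : ℝ) (Z : Finset ℝ), ↑Z ⊆ Set.Ioo (0 : ℝ) N ∧ Z.card = n ∧
      p = C c * ∏ z ∈ Z, (X - C z) := by
  obtain ⟨Z, hZ, ⟨s, hs⟩, hsign⟩ := exists_finset_sign_mul_prod (a := 0) (b := N) p hp
  set r : ℝ[X] := ∏ z ∈ Z, (X - C z) with hr
  have hrdeg : r.natDegree = Z.card := natDegree_finsetProd_X_sub_C_eq_card Z _
  have hr0 : r ≠ 0 := by rintro h; rw [h, zero_mul] at hs; exact hp hs
  have hs0 : s ≠ 0 := by rintro rfl; rw [mul_zero] at hs; exact hp hs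
  have hsum : p.natDegree = Z.card + s.natDegree := by rw [hs, natDegree_mul hr0 hs0, hrdeg]
  have hnZ : n ≤ Z.card := by
    by_contra! hlt
    have h0 := horth r (by
      rw [degree_eq_natDegree hr0, hrdeg]
      exact_mod_cast hlt)
    have hterm : ∀ i ∈ Finset.range (N + 1), w i * p.eval (i : ℝ) * r.eval (i : ℝ) = 0 := by
      have hmem (i : ℕ) (hi : i ∈ Finset.range (N + 1)) : (i : ℝ) ∈ Set.Icc (0 : ℝ) N :=
        ⟨i.cast_nonneg, by exact_mod_cast Nat.lt_succ_iff.mp (Finset.mem_range.mp hi)⟩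
      rcases hsign with h | h
      · refine (Finset.sum_eq_zero_iff_of_nonneg fun i hi => ?_).mp h0
        have := h _ (hmem i hi)
        rw [eval_mul] at this
        rw [mul_assoc]
        exact mul_nonneg (hw i hi) this
      · refine (Finset.sum_eq_zero_iff_of_nonpos fun i hi => ?_).mp h0
        have := h _ (hmem i hi)
        rw [eval_mul] at this
        rw [mul_assoc]
        exact mul_nonpos_of_nonneg_of_nonpos (hw i hi) this
    refine hp (eq_zero_of_natDegree_lt_card_of_eval_eq_zero' p (S.map Nat.castEmbedding) ?_ ?_)
    · intro y hy
      obtain ⟨i, hi, rfl⟩ := Finset.mem_map.mp hy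
      have h1 := hterm i (hS hi)
      rw [mul_assoc] at h1
      have h2 := (mul_eq_zero.mp h1).resolve_left (hwS i hi).ne'
      rcases mul_eq_zero.mp h2 with h | h
      · exact h
      · simp only [Nat.castEmbedding_apply]
        rw [hs, eval_mul, h, zero_mul]
    · rw [Finset.card_map]
      omega
  refine ⟨s.coeff 0, Z, hZ, by omega, ?_⟩
  rw [← eq_C_of_natDegree_eq_zero (by omega : s.natDegree = 0), hs, mul_comm]

/-- Orthogonality to a basis of the polynomials of degree less than `k`. -/
theorem sum_mul_eval_eq_zero_of_degree_lt {N k : ℕ} (w : ℕ → ℝ) (q : ℕ → ℝ[X])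
    (hdeg : ∀ j < k, (q j).natDegree ≤ j) (hcoeff : ∀ j < k, (q j).coeff j ≠ 0) (p : ℝ[X])
    (horth : ∀ j < k, ∑ i ∈ Finset.range (N + 1), w i * p.eval (i : ℝ) * (q j).eval (i : ℝ) = 0)
    (r : ℝ[X]) (hr : r.degree < k) :
    ∑ i ∈ Finset.range (N + 1), w i * p.eval (i : ℝ) * r.eval (i : ℝ) = 0 := by
  suffices h : ∀ d ≤ k, ∀ r : ℝ[X], r.degree < d →
      ∑ i ∈ Finset.range (N + 1), w i * p.eval (i : ℝ) * r.eval (i : ℝ) = 0 from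
    h k le_rfl r hr
  intro d
  induction d with
  | zero =>
    intro _ r hr
    have : r = 0 := by simpa using hr
    simp [this]
  | succ d ih =>
    intro hd r hr
    set c := r.coeff d / (q d).coeff d with hc
    have hlow : (r - C c * q d).degree < d := by
      rw [degree_lt_iff_coeff_zero]
      intro m hm
      rw [coeff_sub, coeff_C_mul]
      rcases hm.eq_or_lt with rfl | hm
      · rw [hc, div_mul_cancel₀ _ (hcoeff d hd), sub_self]
      · rw [(degree_lt_iff_coeff_zero r (d + 1)).mp hr m hm,
          coeff_eq_zero_of_natDegree_lt ((hdeg d hd).trans_lt hm), mul_zero, sub_zero]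
    have h := ih (by omega) _ hlow
    have h2 := horth d hd
    simp only [eval_sub, eval_mul, eval_C, mul_sub, Finset.sum_sub_distrib] at h
    rw [sub_eq_zero] at h
    rw [h]
    calc ∑ i ∈ Finset.range (N + 1), w i * p.eval (i : ℝ) * (c * (q d).eval (i : ℝ))
        = c * ∑ i ∈ Finset.range (N + 1), w i * p.eval (i : ℝ) * (q d).eval (i : ℝ) := by
          rw [Finset.mul_sum]
          refine Finset.sum_congr rfl fun i _ => ?_
          ring
      _ = 0 := by rw [h2, mul_zero]

/-- A bound for the functional `F ↦ ∑ w_i F[x, i] ρ(i)` for `ρ` orthogonal to the polynomials of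
degree less than `n`, by interpolation at `x` and at the zeros of `ρ`. -/
theorem abs_sum_dividedDifference_le {N n : ℕ} (w : ℕ → ℝ)
    (hw : ∀ i ∈ Finset.range (N + 1), 0 ≤ w i) (ρ : ℝ[X])
    (horth : ∀ r : ℝ[X], r.degree < n →
      ∑ i ∈ Finset.range (N + 1), w i * ρ.eval (i : ℝ) * r.eval (i : ℝ) = 0)
    (ℓ : ℕ → ℝ) (hℓ : ∀ i ∈ Finset.range (N + 1), 0 ≤ ℓ i) (c : ℝ) (Z : Finset ℝ)
    (hZ : Z.card = n)
    (hρ : ∀ i ∈ Finset.range (N + 1), ρ.eval (i : ℝ) = c * ℓ i * ∏ z ∈ Z, ((i : ℝ) - z))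
    (x : ℝ) (hx : ∀ i ∈ Finset.range (N + 1), x ≠ i) (F : ℝ → ℝ) (B : ℝ) (p : ℝ[X])
    (hp : p.degree < (n + 1 : ℕ)) (hpx : F x = p.eval x)
    (hF : ∀ i ∈ Finset.range (N + 1),
      |F i - p.eval (i : ℝ)| ≤ B * (|(i : ℝ) - x| * ∏ z ∈ Z, |(i : ℝ) - z|)) :
    |∑ i ∈ Finset.range (N + 1), w i * ((F x - F i) / (x - i)) * ρ.eval (i : ℝ)| ≤
      B * |∑ i ∈ Finset.range (N + 1), w i * ρ.eval (i : ℝ) * (i : ℝ) ^ n| := by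
  obtain ⟨R, hR⟩ : (X - C x) ∣ p - C (p.eval x) := by
    rw [dvd_iff_isRoot]
    simp
  have hRdeg : R.degree < n := by
    by_cases hR0 : R = 0
    · rw [hR0, degree_zero]
      exact WithBot.bot_lt_coe n
    have h1 : (p - C (p.eval x)).degree < (n + 1 : ℕ) :=
      (degree_sub_le _ _).trans_lt (max_lt hp
        (degree_C_le.trans_lt (by exact_mod_cast Nat.succ_pos n)))
    rw [hR, degree_mul, degree_X_sub_C, degree_eq_natDegree hR0] at h1
    rw [degree_eq_natDegree hR0]
    have h2 : 1 + R.natDegree < n + 1 := by exact_mod_cast h1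
    exact_mod_cast (by omega : R.natDegree < n)
  have hRe (y : ℝ) : p.eval y - p.eval x = (y - x) * R.eval y := by
    have := congrArg (eval y) hR
    simpa using this
  have hprod : (∏ z ∈ Z, (X - C z) - X ^ n : ℝ[X]).degree < n := by
    have hmonic : (∏ z ∈ Z, (X - C z) : ℝ[X]).Monic := monic_prod_X_sub_C _ _
    have hdz : (∏ z ∈ Z, (X - C z) : ℝ[X]).degree = n := by
      rw [degree_eq_natDegree hmonic.ne_zero, natDegree_finsetProd_X_sub_C_eq_card Z, hZ]
    have := degree_sub_lt_left (p := ∏ z ∈ Z, (X - C z)) (q := (X ^ n : ℝ[X]))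
      (by rw [hdz, degree_X_pow]) hmonic.ne_zero (by rw [hmonic.leadingCoeff, leadingCoeff_X_pow])
    rwa [hdz] at this
  have hmoment : ∑ i ∈ Finset.range (N + 1), w i * ρ.eval (i : ℝ) * (i : ℝ) ^ n =
      ∑ i ∈ Finset.range (N + 1), w i * ρ.eval (i : ℝ) * ∏ z ∈ Z, ((i : ℝ) - z) := by
    have h := horth _ hprod
    simp only [eval_sub, eval_prod, eval_pow, eval_X, eval_C, mul_sub, Finset.sum_sub_distrib] at h
    linarith
  have habs : ∑ i ∈ Finset.range (N + 1), w i * (|ρ.eval (i : ℝ)| * ∏ z ∈ Z, |(i : ℝ) - z|) =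
      |∑ i ∈ Finset.range (N + 1), w i * ρ.eval (i : ℝ) * ∏ z ∈ Z, ((i : ℝ) - z)| := by
    have h1 : ∑ i ∈ Finset.range (N + 1), w i * ρ.eval (i : ℝ) * ∏ z ∈ Z, ((i : ℝ) - z) =
        c * ∑ i ∈ Finset.range (N + 1), w i * ℓ i * (∏ z ∈ Z, ((i : ℝ) - z)) ^ 2 := by
      rw [Finset.mul_sum]
      refine Finset.sum_congr rfl fun i hi => ?_
      rw [hρ i hi]
      ring
    rw [h1, abs_mul, abs_of_nonneg (Finset.sum_nonneg fun i hi =>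
      mul_nonneg (mul_nonneg (hw i hi) (hℓ i hi)) (sq_nonneg _)), Finset.mul_sum]
    refine Finset.sum_congr rfl fun i hi => ?_
    rw [hρ i hi, abs_mul, abs_mul, abs_of_nonneg (hℓ i hi), ← Finset.abs_prod,
      ← sq_abs (∏ z ∈ Z, _)]
    ring
  have hreduce : ∑ i ∈ Finset.range (N + 1), w i * ((F x - F i) / (x - i)) * ρ.eval (i : ℝ) =
      ∑ i ∈ Finset.range (N + 1), w i * ((F i - p.eval (i : ℝ)) / (i - x)) * ρ.eval (i : ℝ) := by
    have h0 := horth R hRdeg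
    rw [← sub_eq_zero, ← Finset.sum_sub_distrib, ← h0]
    refine Finset.sum_congr rfl fun i hi => ?_
    have h1 : x - i ≠ 0 := sub_ne_zero.mpr (hx i hi)
    have h2 : (i : ℝ) - x ≠ 0 := sub_ne_zero.mpr (hx i hi).symm
    have h3 : R.eval (i : ℝ) = (p.eval (i : ℝ) - p.eval x) / (i - x) := by
      rw [hRe, mul_div_cancel_left₀ _ h2]
    have h4 : (F x - F i) / (x - i) = (F i - F x) / (i - x) := by
      rw [← neg_sub (F i), ← neg_sub (i : ℝ) x, neg_div_neg_eq]
    rw [h3, h4, hpx]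
    field_simp
    ring
  rw [hreduce, hmoment, ← habs, Finset.mul_sum]
  refine (Finset.abs_sum_le_sum_abs _ _).trans (Finset.sum_le_sum fun i hi => ?_)
  have h2 : 0 < |(i : ℝ) - x| := abs_pos.mpr (sub_ne_zero.mpr (hx i hi).symm)
  have h5 : |F i - p.eval (i : ℝ)| / |(i : ℝ) - x| ≤ B * ∏ z ∈ Z, |(i : ℝ) - z| := by
    rw [div_le_iff₀ h2]
    refine (hF i hi).trans_eq ?_
    ring
  rw [abs_mul, abs_mul, abs_of_nonneg (hw i hi), abs_div]
  calc w i * (|F i - p.eval (i : ℝ)| / |(i : ℝ) - x|) * |ρ.eval (i : ℝ)|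
      ≤ w i * (B * ∏ z ∈ Z, |(i : ℝ) - z|) * |ρ.eval (i : ℝ)| := by
        gcongr
        exact hw i hi
    _ = B * (w i * (|ρ.eval (i : ℝ)| * ∏ z ∈ Z, |(i : ℝ) - z|)) := by ring

/-- The remainder of an orthogonal expansion, from the Christoffel–Darboux kernel. -/
theorem sub_orthogonalExpansion_eq {N n : ℕ} (hn : n + 1 ≤ N) (w : ℕ → ℝ)
    (hw : ∀ i ∈ Finset.range (N + 1), 0 < w i) (q : ℕ → ℝ[X])
    (hdeg : ∀ j, (q j).natDegree ≤ j) (hcoeff : ∀ j ≤ n + 1, (q j).coeff j ≠ 0)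
    (horth : ∀ j ≤ n + 1, ∀ k ≤ n + 1, j ≠ k →
      ∑ i ∈ Finset.range (N + 1), w i * (q j).eval (i : ℝ) * (q k).eval (i : ℝ) = 0)
    (x : ℝ) (hx : ∀ i ∈ Finset.range (N + 1), x ≠ i) (hqx : (q n).eval x ≠ 0) (F : ℝ → ℝ) :
    F x - ∑ k ∈ Finset.range (n + 1),
        (∑ i ∈ Finset.range (N + 1), w i * F i * (q k).eval (i : ℝ)) /
          (∑ i ∈ Finset.range (N + 1), w i * (q k).eval (i : ℝ) * (q k).eval (i : ℝ)) *
          (q k).eval x =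
      (q n).coeff n / ((q (n + 1)).coeff (n + 1) *
        ∑ i ∈ Finset.range (N + 1), w i * (q n).eval (i : ℝ) * (q n).eval (i : ℝ)) *
      ∑ i ∈ Finset.range (N + 1), w i * ((F x - F i) / (x - i)) *
        ((q (n + 1)).eval x * (q n).eval (i : ℝ) - (q n).eval x * (q (n + 1)).eval (i : ℝ)) := by
  have hlow : ∀ j ≤ n + 1, ∀ r : ℝ[X], r.degree < j →
      ∑ i ∈ Finset.range (N + 1), w i * (q j).eval (i : ℝ) * r.eval (i : ℝ) = 0 :=
    fun j hj r hr => sum_mul_eval_eq_zero_of_degree_lt w q (fun k _ => hdeg k)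
      (fun k hk => hcoeff k (by omega)) (q j)
      (fun k hk => horth j hj k (by omega) (by omega)) r hr
  set h : ℕ → ℝ := fun k =>
    ∑ i ∈ Finset.range (N + 1), w i * (q k).eval (i : ℝ) * (q k).eval (i : ℝ) with hh
  have hpos : ∀ k ≤ n, h k ≠ 0 := by
    intro k hk h0
    have hterm := (Finset.sum_eq_zero_iff_of_nonneg fun i hi => by
      rw [mul_assoc]
      exact mul_nonneg (hw i hi).le (mul_self_nonneg _)).mp h0
    have hq0 : q k = 0 := by
      refine eq_zero_of_natDegree_lt_card_of_eval_eq_zero' (q k)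
        ((Finset.range (N + 1)).map Nat.castEmbedding) ?_ ?_
      · intro y hy
        obtain ⟨i, hi, rfl⟩ := Finset.mem_map.mp hy
        have h1 := hterm i hi
        rw [mul_assoc] at h1
        exact mul_self_eq_zero.mp ((mul_eq_zero.mp h1).resolve_left (hw i hi).ne')
      · rw [Finset.card_map, Finset.card_range]
        have := hdeg k
        omega
    exact hcoeff k (by omega) (by rw [hq0, coeff_zero])
  set a := (q (n + 1)).eval x with ha
  set b := (q n).eval x with hb
  set k₀ := (q n).coeff n with hk₀
  set k₁ := (q (n + 1)).coeff (n + 1) with hk₁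
  have hk₀' : k₀ ≠ 0 := hcoeff n (by omega)
  have hk₁' : k₁ ≠ 0 := hcoeff (n + 1) le_rfl
  obtain ⟨G, hG⟩ : (X - C x) ∣ C a * q n - C b * q (n + 1) := by
    rw [dvd_iff_isRoot]
    simp only [IsRoot.def, eval_sub, eval_mul, eval_C, ← ha, ← hb]
    ring
  have hGe (y : ℝ) : a * (q n).eval y - b * (q (n + 1)).eval y = (y - x) * G.eval y := by
    have := congrArg (eval y) hG
    simpa using this
  have hGdeg : G.natDegree ≤ n := by
    by_cases hG0 : G = 0
    · simp [hG0]
    have h1 : (C a * q n - C b * q (n + 1)).natDegree ≤ n + 1 :=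
      (natDegree_sub_le _ _).trans (max_le
        ((natDegree_C_mul_le _ _).trans ((hdeg n).trans n.le_succ))
        ((natDegree_C_mul_le _ _).trans (hdeg (n + 1))))
    rw [hG, natDegree_mul (X_sub_C_ne_zero x) hG0, natDegree_X_sub_C] at h1
    omega
  have hGcoeff : G.coeff n = -b * k₁ := by
    have h1 := congrArg (fun p : ℝ[X] => p.coeff (n + 1)) hG
    simp only [coeff_sub, coeff_C_mul, sub_mul, coeff_X_mul] at h1
    rw [coeff_eq_zero_of_natDegree_lt ((hdeg n).trans_lt n.lt_succ_self),
      coeff_eq_zero_of_natDegree_lt (hGdeg.trans_lt n.lt_succ_self)] at h1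
    linarith
  set I₀ := ∑ i ∈ Finset.range (N + 1), w i * G.eval (i : ℝ) with hI₀
  have hrepr (r : ℝ[X]) (hr : r.natDegree ≤ n) :
      ∑ i ∈ Finset.range (N + 1), w i * G.eval (i : ℝ) * r.eval (i : ℝ) = r.eval x * I₀ := by
    obtain ⟨R, hR⟩ : (X - C x) ∣ r - C (r.eval x) := by
      rw [dvd_iff_isRoot]
      simp
    have hRe (y : ℝ) : r.eval y = r.eval x + (y - x) * R.eval y := by
      have := congrArg (eval y) hR
      simp only [eval_sub, eval_C, eval_mul, eval_X] at this
      linarith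
    have hRdeg : R.degree < n := by
      by_cases hR0 : R = 0
      · rw [hR0, degree_zero]
        exact WithBot.bot_lt_coe n
      have h1 : (r - C (r.eval x)).natDegree ≤ n :=
        (natDegree_sub_le _ _).trans (max_le hr (by rw [natDegree_C]; exact n.zero_le))
      rw [hR, natDegree_mul (X_sub_C_ne_zero x) hR0, natDegree_X_sub_C] at h1
      rw [degree_eq_natDegree hR0]
      exact_mod_cast (by omega : R.natDegree < n)
    have h1 := hlow n (by omega) R hRdeg
    have h2 := hlow (n + 1) le_rfl R (hRdeg.trans (by exact_mod_cast n.lt_succ_self))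
    calc ∑ i ∈ Finset.range (N + 1), w i * G.eval (i : ℝ) * r.eval (i : ℝ)
        = ∑ i ∈ Finset.range (N + 1), (r.eval x * (w i * G.eval (i : ℝ)) +
            (a * (w i * (q n).eval (i : ℝ) * R.eval (i : ℝ)) -
              b * (w i * (q (n + 1)).eval (i : ℝ) * R.eval (i : ℝ)))) := by
          refine Finset.sum_congr rfl fun i _ => ?_
          rw [hRe i]
          linear_combination (-w i * R.eval (i : ℝ)) * hGe i
      _ = r.eval x * I₀ := by
          rw [Finset.sum_add_distrib, Finset.sum_sub_distrib, ← Finset.mul_sum, ← Finset.mul_sum,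
            ← Finset.mul_sum, h1, h2, mul_zero, mul_zero, sub_zero, add_zero]
  have hI : I₀ * k₀ = -(k₁ * h n) := by
    have h1 := hrepr (q n) (hdeg n)
    have hlt : (G - C (G.coeff n / k₀) * q n).degree < n := by
      rw [degree_lt_iff_coeff_zero]
      intro m hm
      rw [coeff_sub, coeff_C_mul]
      rcases hm.eq_or_lt with rfl | hm
      · rw [← hk₀, div_mul_cancel₀ _ hk₀', sub_self]
      · rw [coeff_eq_zero_of_natDegree_lt (hGdeg.trans_lt hm),
          coeff_eq_zero_of_natDegree_lt ((hdeg n).trans_lt hm), mul_zero, sub_zero]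
    have h2 := hlow n (by omega) _ hlt
    have h3 : ∑ i ∈ Finset.range (N + 1), w i * G.eval (i : ℝ) * (q n).eval (i : ℝ) =
        G.coeff n / k₀ * h n := by
      rw [← sub_eq_zero, ← h2, hh, Finset.mul_sum, ← Finset.sum_sub_distrib]
      refine Finset.sum_congr rfl fun i _ => ?_
      simp only [eval_sub, eval_mul, eval_C]
      ring
    rw [h1, hGcoeff] at h3
    field_simp at h3
    refine mul_left_cancel₀ hqx ?_
    linear_combination h3
  have hI0 : I₀ ≠ 0 := by
    intro h0
    rw [h0, zero_mul, eq_comm, neg_eq_zero] at hI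
    exact mul_ne_zero hk₁' (hpos n le_rfl) hI
  set A := k₀ / (k₁ * h n) with hA
  have hAI : A * I₀ = -1 := by
    have := hpos n le_rfl
    rw [hA]
    field_simp
    linear_combination hI
  let D : ℝ[X] := ∑ k ∈ Finset.range (n + 1), C ((q k).eval x / h k) * q k + C A * G
  have hDe (y : ℝ) : D.eval y =
      ∑ k ∈ Finset.range (n + 1), (q k).eval x / h k * (q k).eval y + A * G.eval y := by
    simp [D, eval_finsetSum]
  have hDdeg : D.degree < (n + 1 : ℕ) := by
    have h1 : D.natDegree ≤ n := by
      refine (natDegree_add_le _ _).trans (max_le ?_ ((natDegree_C_mul_le _ _).trans hGdeg))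
      refine natDegree_sum_le_of_forall_le _ _ fun k hk => ?_
      exact (natDegree_C_mul_le _ _).trans
        ((hdeg k).trans (Nat.lt_succ_iff.mp (Finset.mem_range.mp hk)))
    exact degree_le_natDegree.trans_lt (by exact_mod_cast Nat.lt_succ_of_le h1)
  have hDorth : ∀ j < n + 1,
      ∑ i ∈ Finset.range (N + 1), w i * D.eval (i : ℝ) * (q j).eval (i : ℝ) = 0 := by
    intro j hj
    have h1 := hrepr (q j) ((hdeg j).trans (by omega))
    calc ∑ i ∈ Finset.range (N + 1), w i * D.eval (i : ℝ) * (q j).eval (i : ℝ)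
        = ∑ i ∈ Finset.range (N + 1), (∑ k ∈ Finset.range (n + 1), (q k).eval x / h k *
            (w i * (q k).eval (i : ℝ) * (q j).eval (i : ℝ)) +
            A * (w i * G.eval (i : ℝ) * (q j).eval (i : ℝ))) := by
          refine Finset.sum_congr rfl fun i _ => ?_
          rw [hDe, mul_add, add_mul, Finset.mul_sum, Finset.sum_mul]
          congr 1
          · refine Finset.sum_congr rfl fun k _ => ?_
            ring
          · ring
      _ = (q j).eval x / h j * h j + A * ((q j).eval x * I₀) := by
          rw [Finset.sum_add_distrib, Finset.sum_comm, ← Finset.mul_sum, h1]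
          congr 1
          simp only [← Finset.mul_sum]
          rw [Finset.sum_eq_single j]
          · intro k hk hkj
            rw [horth k (Finset.mem_range.mp hk).le j hj.le hkj, mul_zero]
          · intro hj'
            exact absurd (Finset.mem_range.mpr hj) hj'
      _ = 0 := by
          rw [div_mul_cancel₀ _ (hpos j (by omega))]
          linear_combination (q j).eval x * hAI
  have hD0 : ∀ i ∈ Finset.range (N + 1), D.eval (i : ℝ) = 0 := by
    have h1 := sum_mul_eval_eq_zero_of_degree_lt (k := n + 1) w q (fun k _ => hdeg k)
      (fun k hk => hcoeff k (by omega)) D hDorth D hDdeg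
    have hterm := (Finset.sum_eq_zero_iff_of_nonneg fun i hi => by
      rw [mul_assoc]
      exact mul_nonneg (hw i hi).le (mul_self_nonneg _)).mp h1
    intro i hi
    have h2 := hterm i hi
    rw [mul_assoc] at h2
    exact mul_self_eq_zero.mp ((mul_eq_zero.mp h2).resolve_left (hw i hi).ne')
  have hexp : ∑ k ∈ Finset.range (n + 1),
      (∑ i ∈ Finset.range (N + 1), w i * F i * (q k).eval (i : ℝ)) / h k * (q k).eval x =
      -A * ∑ i ∈ Finset.range (N + 1), w i * F i * G.eval (i : ℝ) := by
    simp only [Finset.sum_div, Finset.sum_mul]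
    rw [Finset.sum_comm, Finset.mul_sum]
    refine Finset.sum_congr rfl fun i hi => ?_
    have h1 := hD0 i hi
    rw [hDe] at h1
    have h2 : ∑ k ∈ Finset.range (n + 1), w i * F i * (q k).eval (i : ℝ) / h k * (q k).eval x =
        w i * F i * ∑ k ∈ Finset.range (n + 1), (q k).eval x / h k * (q k).eval (i : ℝ) := by
      rw [Finset.mul_sum]
      refine Finset.sum_congr rfl fun k _ => ?_
      ring
    rw [h2]
    linear_combination w i * F i * h1
  have hrhs : ∑ i ∈ Finset.range (N + 1), w i * ((F x - F i) / (x - i)) *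
        (a * (q n).eval (i : ℝ) - b * (q (n + 1)).eval (i : ℝ)) =
      ∑ i ∈ Finset.range (N + 1), w i * F i * G.eval (i : ℝ) - F x * I₀ := by
    rw [hI₀, Finset.mul_sum, ← Finset.sum_sub_distrib]
    refine Finset.sum_congr rfl fun i hi => ?_
    have h1 : x - i ≠ 0 := sub_ne_zero.mpr (hx i hi)
    rw [hGe]
    field_simp
    ring
  rw [hexp, hrhs]
  linear_combination F x * hAI

end DiscreteOrthogonality

section HahnRemainder

open Polynomial

/-- `F` can be interpolated at any `n + 1` points of `[0, N]` by a polynomial of degree at most `n`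
with an error of at most `B` times the nodal polynomial. -/
def InterpolationBound (N n : ℕ) (F : ℝ → ℝ) (B : ℝ) : Prop :=
  ∀ s : Finset ℝ, ↑s ⊆ Set.Icc (0 : ℝ) N → s.card = n + 1 →
    ∃ p : ℝ[X], p.degree < (n + 1 : ℕ) ∧
      ∀ y ∈ Set.Icc (0 : ℝ) N, |F y - p.eval y| ≤ B * ∏ z ∈ s, |y - z|

theorem abs_sum_dividedDifference_le_of_eval_eq_zero {N n : ℕ} (hn : n < N) (w : ℕ → ℝ)
    (hw : ∀ i ∈ Finset.range (N + 1), 0 < w i) (ρ : ℝ[X]) (hρ0 : ρ ≠ 0)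
    (hρdeg : ρ.natDegree ≤ n + 1)
    (horth : ∀ r : ℝ[X], r.degree < n →
      ∑ i ∈ Finset.range (N + 1), w i * ρ.eval (i : ℝ) * r.eval (i : ℝ) = 0)
    (σ : ℝ) (e : ℕ) (he : e ≤ N) (hσ : ∀ i ∈ Finset.range (N + 1), i ≠ e → 0 < σ * ((i : ℝ) - e))
    (hρe : ρ.eval (e : ℝ) = 0) :
    ∃ Z : Finset ℝ, ∀ x ∈ Set.Icc (0 : ℝ) N, x ∉ Z → (∀ i ∈ Finset.range (N + 1), x ≠ i) →
      ∀ (F : ℝ → ℝ) (B : ℝ), InterpolationBound N n F B →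
        |∑ i ∈ Finset.range (N + 1), w i * ((F x - F i) / (x - i)) * ρ.eval (i : ℝ)| ≤
          B * |∑ i ∈ Finset.range (N + 1), w i * ρ.eval (i : ℝ) * (i : ℝ) ^ n| := by
  classical
  obtain ⟨P, hP⟩ := dvd_iff_isRoot.mpr hρe
  have hP0 : P ≠ 0 := by rintro rfl; exact hρ0 (by rw [hP, mul_zero])
  have hPdeg : P.natDegree ≤ n := by
    rw [hP, natDegree_mul (X_sub_C_ne_zero _) hP0, natDegree_X_sub_C] at hρdeg
    omega
  have hρP (y : ℝ) : ρ.eval y = (y - e) * P.eval y := by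
    have := congrArg (eval y) hP
    simpa using this
  have heN : e ∈ Finset.range (N + 1) := Finset.mem_range.mpr (Nat.lt_succ_of_le he)
  have hσ' : ∀ i ∈ Finset.range (N + 1), 0 ≤ σ * ((i : ℝ) - e) := by
    intro i hi
    by_cases hie : i = e
    · simp [hie]
    · exact (hσ i hi hie).le
  have hσ0 : σ ≠ 0 := by
    rintro rfl
    by_cases h0 : e = 0
    · exact lt_irrefl (0 : ℝ) (by simpa using hσ N (by simp) (by omega))
    · exact lt_irrefl (0 : ℝ) (by simpa using hσ 0 (by simp) (Ne.symm h0))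
  obtain ⟨c, Z, hZ, hZcard, hPZ⟩ := exists_finset_zeros_of_orthogonal (N := N) (n := n)
    (fun i => w i * (σ * ((i : ℝ) - e))) (fun i hi => mul_nonneg (hw i hi).le (hσ' i hi))
    ((Finset.range (N + 1)).erase e) (Finset.erase_subset _ _)
    (by rw [Finset.card_erase_of_mem heN, Finset.card_range]; omega)
    (fun i hi => mul_pos (hw i (Finset.mem_of_mem_erase hi))
      (hσ i (Finset.mem_of_mem_erase hi) (Finset.ne_of_mem_erase hi)))
    P hP0 hPdeg
    (by
      intro r hr
      rw [← mul_zero σ, ← horth r hr, Finset.mul_sum]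
      refine Finset.sum_congr rfl fun i _ => ?_
      rw [hρP]
      ring)
  refine ⟨Z, fun x hx hxZ hxi F B hF => ?_⟩
  obtain ⟨p, hp, hpF⟩ := hF (insert x Z)
    (by
      rw [Finset.coe_insert]
      exact Set.insert_subset hx (hZ.trans Set.Ioo_subset_Icc_self))
    (by rw [Finset.card_insert_of_notMem hxZ, hZcard])
  refine abs_sum_dividedDifference_le w (fun i hi => (hw i hi).le) ρ horth
    (fun i => σ * ((i : ℝ) - e)) hσ' (c / σ) Z hZcard ?_ x hxi F B p hp ?_ ?_
  · intro i _
    rw [hρP, hPZ]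
    simp only [eval_mul, eval_C, eval_prod, eval_sub, eval_X]
    field_simp
  · have h := hpF x hx
    rw [Finset.prod_insert hxZ, sub_self, abs_zero, zero_mul, mul_zero] at h
    exact sub_eq_zero.mp (abs_nonpos_iff.mp h)
  · intro i hi
    have h := hpF i ⟨i.cast_nonneg, by exact_mod_cast Nat.lt_succ_iff.mp (Finset.mem_range.mp hi)⟩
    rwa [Finset.prod_insert hxZ] at h

theorem hahnQ_zero_right (k : ℕ) (α : ℝ) (N : ℕ) : hahnQ k α α N 0 = 1 := by
  rw [hahnQ_eq_sum k α N 0 le_rfl, Finset.sum_range_succ', Finset.sum_eq_zero]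
  · simp [hahnCoeff_zero, pochhammer_zero_right]
  · intro j _
    rw [pochhammer_succ_left, neg_zero, zero_mul, mul_zero]

theorem hahnQ_add_succ_endpoint {α : ℝ} (hα : -1 < α) {k N : ℕ} (hk : k + 2 ≤ N) :
    hahnQ k α α N N + hahnQ (k + 1) α α N N = 0 := by
  rw [hahnQ_add_succ hα hk, sub_self, zero_mul]

/-- The remainder of the Hahn expansion in the variable of the Hahn polynomials. -/
theorem abs_sub_sum_hahnQ_le {α : ℝ} (hα : -(1 / 2 : ℝ) < α) {n N : ℕ} (hn : 1 ≤ n)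
    (hN : n + 2 ≤ N) (hdeg : 2 * (n : ℝ) * (n + 2 * α + 1) ≤ N * (2 * α + 1)) (F : ℝ → ℝ)
    (hFc : ContinuousOn F (Set.Icc (0 : ℝ) N)) (B : ℝ) (hB : 0 ≤ B)
    (hF : InterpolationBound N n F B) {x : ℝ} (hx : x ∈ Set.Icc (0 : ℝ) N) :
    |F x - ∑ k ∈ Finset.range (n + 1), hahnInner α α N F (hahnQ k α α N) /
      hahnInner α α N (hahnQ k α α N) (hahnQ k α α N) * hahnQ k α α N x| ≤
      B * |hahnCoeff (n + 1 : ℕ) α N (n + 1)|⁻¹ := by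
  classical
  have hα1 : -1 < α := by linarith
  set w := hahnWeight α α N with hw
  have hwpos : ∀ i ∈ Finset.range (N + 1), 0 < w i := fun i _ => hahnWeight_pos hα1 N i
  set q : ℕ → ℝ[X] := fun k => hahnPoly k α N with hq
  have hqe (k : ℕ) (y : ℝ) : (q k).eval y = hahnQ k α α N y := eval_hahnPoly k α N y
  have hqdeg (k : ℕ) : (q k).natDegree ≤ k := natDegree_hahnPoly_le k α N
  have hqc : ∀ k ≤ n + 1, (q k).coeff k ≠ 0 := by
    intro k hk
    rw [hq, coeff_hahnPoly]
    exact mul_ne_zero (pow_ne_zero _ (by norm_num)) (hahnCoeff_self_ne_zero (by omega) hα)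
  have hinner (G : ℝ → ℝ) (k : ℕ) : hahnInner α α N G (hahnQ k α α N) =
      ∑ i ∈ Finset.range (N + 1), w i * G i * (q k).eval (i : ℝ) := by
    rw [hahnInner]
    refine Finset.sum_congr rfl fun i _ => ?_
    rw [hqe, hw]
    ring
  have hinner' (j k : ℕ) : hahnInner α α N (hahnQ j α α N) (hahnQ k α α N) =
      ∑ i ∈ Finset.range (N + 1), w i * (q j).eval (i : ℝ) * (q k).eval (i : ℝ) := by
    rw [hinner]
    simp only [hqe]
  have horth : ∀ j ≤ n + 1, ∀ k ≤ n + 1, j ≠ k →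
      ∑ i ∈ Finset.range (N + 1), w i * (q j).eval (i : ℝ) * (q k).eval (i : ℝ) = 0 := by
    intro j hj k hk hjk
    rw [← hinner']
    exact hahnInner_hahnQ_of_ne hα (by omega) (by omega) hjk
  have hlow : ∀ j ≤ n + 1, ∀ r : ℝ[X], r.degree < j →
      ∑ i ∈ Finset.range (N + 1), w i * (q j).eval (i : ℝ) * r.eval (i : ℝ) = 0 :=
    fun j hj r hr => sum_mul_eval_eq_zero_of_degree_lt w q (fun k _ => hqdeg k)
      (fun k hk => hqc k (by omega)) (q j)
      (fun k hk => horth j hj k (by omega) (by omega)) r hr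
  set m := ∑ i ∈ Finset.range (N + 1), w i * (q n).eval (i : ℝ) * (i : ℝ) ^ n with hm
  have hh : ∑ i ∈ Finset.range (N + 1), w i * (q n).eval (i : ℝ) * (q n).eval (i : ℝ) =
      (q n).coeff n * m := by
    have hlt : (q n - C ((q n).coeff n) * X ^ n).degree < (n : WithBot ℕ) := by
      rw [degree_lt_iff_coeff_zero]
      intro j hj
      rw [coeff_sub, coeff_C_mul, coeff_X_pow]
      rcases hj.eq_or_lt with rfl | hj
      · simp
      · rw [coeff_eq_zero_of_natDegree_lt ((hqdeg n).trans_lt hj), if_neg (by omega), mul_zero,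
          sub_zero]
    have h := hlow n (by omega) _ hlt
    rw [← sub_eq_zero, ← h, hm, Finset.mul_sum, ← Finset.sum_sub_distrib]
    refine Finset.sum_congr rfl fun i _ => ?_
    simp only [eval_sub, eval_mul, eval_C, eval_pow, eval_X]
    ring
  have hXn : (X ^ n : ℝ[X]).degree < (n + 1 : ℕ) := by
    rw [degree_X_pow]
    exact_mod_cast n.lt_succ_self
  have hside (τ : ℝ) (hτ : τ ≠ 0) (σ : ℝ) (e : ℕ) (he : e ≤ N)
      (hσ : ∀ i ∈ Finset.range (N + 1), i ≠ e → 0 < σ * ((i : ℝ) - e))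
      (hρe : hahnQ n α α N e + τ * hahnQ (n + 1) α α N e = 0) :
      ∃ Z : Finset ℝ, ∀ x ∈ Set.Icc (0 : ℝ) N, x ∉ Z → (∀ i ∈ Finset.range (N + 1), x ≠ i) →
        |∑ i ∈ Finset.range (N + 1), w i * ((F x - F i) / (x - i)) *
          ((q n).eval (i : ℝ) + τ * (q (n + 1)).eval (i : ℝ))| ≤ B * |m| := by
    have hcoeff : (q n + C τ * q (n + 1)).coeff (n + 1) = τ * (q (n + 1)).coeff (n + 1) := by
      rw [coeff_add, coeff_C_mul,
        coeff_eq_zero_of_natDegree_lt ((hqdeg n).trans_lt n.lt_succ_self), zero_add]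
    obtain ⟨Z, hZ⟩ := abs_sum_dividedDifference_le_of_eval_eq_zero (n := n) (by omega) w hwpos
      (q n + C τ * q (n + 1))
      (by
        intro h
        rw [h, coeff_zero] at hcoeff
        exact mul_ne_zero hτ (hqc (n + 1) le_rfl) hcoeff.symm)
      ((natDegree_add_le _ _).trans (max_le ((hqdeg n).trans n.le_succ)
        ((natDegree_C_mul_le _ _).trans (hqdeg (n + 1)))))
      (by
        intro r hr
        have h1 := hlow n (by omega) r hr
        have h2 := hlow (n + 1) le_rfl r (hr.trans (by exact_mod_cast n.lt_succ_self))
        calc _ = ∑ i ∈ Finset.range (N + 1), (w i * (q n).eval (i : ℝ) * r.eval (i : ℝ) +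
              τ * (w i * (q (n + 1)).eval (i : ℝ) * r.eval (i : ℝ))) := by
              refine Finset.sum_congr rfl fun i _ => ?_
              simp only [eval_add, eval_mul, eval_C]
              ring
          _ = 0 := by
              rw [Finset.sum_add_distrib, ← Finset.mul_sum, h1, h2, mul_zero, add_zero])
      σ e he hσ (by simpa [hqe] using hρe)
    refine ⟨Z, fun x hx hxZ hxi => ?_⟩
    have h := hZ x hx hxZ hxi F B hF
    have hmom : ∑ i ∈ Finset.range (N + 1),
        w i * (q n + C τ * q (n + 1)).eval (i : ℝ) * (i : ℝ) ^ n = m := by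
      have h2 := hlow (n + 1) le_rfl _ hXn
      rw [hm, ← sub_eq_zero, ← Finset.sum_sub_distrib, ← mul_zero τ, ← h2, Finset.mul_sum]
      refine Finset.sum_congr rfl fun i _ => ?_
      simp only [eval_add, eval_mul, eval_C, eval_pow, eval_X]
      ring
    rw [hmom] at h
    simpa only [eval_add, eval_mul, eval_C] using h
  have hN' : ∀ i ∈ Finset.range (N + 1), (i : ℝ) ≤ N := fun i hi => by
    exact_mod_cast Nat.lt_succ_iff.mp (Finset.mem_range.mp hi)
  obtain ⟨Z₁, hZ₁⟩ := hside 1 one_ne_zero (-1) N le_rfl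
    (fun i hi hne => by
      have := lt_of_le_of_ne (hN' i hi) (by exact_mod_cast hne)
      linarith)
    (by rw [one_mul, hahnQ_add_succ_endpoint hα1 (by omega)])
  obtain ⟨Z₂, hZ₂⟩ := hside (-1) (by norm_num) 1 0 N.zero_le
    (fun i hi hne => by
      have : (0 : ℝ) < i := by exact_mod_cast Nat.pos_of_ne_zero hne
      simpa using this)
    (by simp [hahnQ_zero_right])
  let T : Finset ℝ := Z₁ ∪ Z₂ ∪ (Finset.range (N + 1)).image (fun i : ℕ => (i : ℝ)) ∪
    (q n).roots.toFinset
  have hgeneric : ∀ y ∈ Set.Ioo (0 : ℝ) N ∩ (↑T : Set ℝ)ᶜ,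
      |F y - ∑ k ∈ Finset.range (n + 1), hahnInner α α N F (hahnQ k α α N) /
        hahnInner α α N (hahnQ k α α N) (hahnQ k α α N) * hahnQ k α α N y| ≤
      B * |hahnCoeff (n + 1 : ℕ) α N (n + 1)|⁻¹ := by
    rintro y ⟨hy, hyT⟩
    have hyI := Set.Ioo_subset_Icc_self hy
    simp only [T, Finset.coe_union, Set.mem_compl_iff, Set.mem_union, not_or, Finset.mem_coe] at hyT
    obtain ⟨⟨⟨hy1, hy2⟩, hy3⟩, hy4⟩ := hyT
    have hyi : ∀ i ∈ Finset.range (N + 1), y ≠ i := by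
      rintro i hi rfl
      exact hy3 (Finset.mem_image_of_mem _ hi)
    have hqn0 : q n ≠ 0 := by
      intro h
      exact hqc n (by omega) (by rw [h, coeff_zero])
    have hqy : (q n).eval y ≠ 0 := fun h =>
      hy4 (Multiset.mem_toFinset.mpr ((mem_roots hqn0).mpr h))
    have hmain := sub_orthogonalExpansion_eq (by omega : n + 1 ≤ N) w hwpos q hqdeg hqc horth y hyi
      hqy F
    have hΛ₁ := hZ₁ y hyI hy1 hyi
    have hΛ₂ := hZ₂ y hyI hy2 hyi
    have hlhs : ∑ k ∈ Finset.range (n + 1), hahnInner α α N F (hahnQ k α α N) /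
        hahnInner α α N (hahnQ k α α N) (hahnQ k α α N) * hahnQ k α α N y =
        ∑ k ∈ Finset.range (n + 1),
        (∑ i ∈ Finset.range (N + 1), w i * F i * (q k).eval (i : ℝ)) /
          (∑ i ∈ Finset.range (N + 1), w i * (q k).eval (i : ℝ) * (q k).eval (i : ℝ)) *
          (q k).eval y :=
      Finset.sum_congr rfl fun k _ => by rw [hinner, hinner', hqe]
    rw [hlhs, hmain, hh]
    set a := (q (n + 1)).eval y with ha
    set b := (q n).eval y with hb
    have hsplit : ∑ i ∈ Finset.range (N + 1), w i * ((F y - F i) / (y - i)) *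
          (a * (q n).eval (i : ℝ) - b * (q (n + 1)).eval (i : ℝ)) =
        (a - b) / 2 * ∑ i ∈ Finset.range (N + 1), w i * ((F y - F i) / (y - i)) *
          ((q n).eval (i : ℝ) + 1 * (q (n + 1)).eval (i : ℝ)) +
        (a + b) / 2 * ∑ i ∈ Finset.range (N + 1), w i * ((F y - F i) / (y - i)) *
          ((q n).eval (i : ℝ) + -1 * (q (n + 1)).eval (i : ℝ)) := by
      rw [Finset.mul_sum, Finset.mul_sum, ← Finset.sum_add_distrib]
      refine Finset.sum_congr rfl fun i _ => ?_
      ring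
    have ha1 : |a| ≤ 1 := by
      rw [ha, hqe]
      exact abs_hahnQ_le_one hα hyI n hN hdeg
    have hb1 : |b| ≤ 1 := by
      obtain ⟨l, rfl⟩ := Nat.exists_eq_add_of_le' hn
      rw [hb, hqe]
      refine abs_hahnQ_le_one hα hyI l (by omega) ?_
      have : (0 : ℝ) ≤ l := l.cast_nonneg
      push_cast at hdeg
      nlinarith
    have hab : |(a - b) / 2| + |(a + b) / 2| ≤ 1 := by
      rw [abs_le] at ha1 hb1
      rcases abs_cases ((a - b) / 2) with h | h <;> rcases abs_cases ((a + b) / 2) with h' | h' <;>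
        linarith [h.1, h'.1]
    have hsum : |∑ i ∈ Finset.range (N + 1), w i * ((F y - F i) / (y - i)) *
          (a * (q n).eval (i : ℝ) - b * (q (n + 1)).eval (i : ℝ))| ≤ B * |m| := by
      rw [hsplit]
      refine (abs_add_le _ _).trans ?_
      rw [abs_mul, abs_mul]
      calc _ ≤ |(a - b) / 2| * (B * |m|) + |(a + b) / 2| * (B * |m|) := by gcongr
        _ = (|(a - b) / 2| + |(a + b) / 2|) * (B * |m|) := by ring
        _ ≤ 1 * (B * |m|) := by gcongr
        _ = B * |m| := one_mul _
    have hm0 : m ≠ 0 := by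
      intro h0
      rw [h0, mul_zero] at hh
      have hterm := (Finset.sum_eq_zero_iff_of_nonneg fun i hi => by
        rw [mul_assoc]
        exact mul_nonneg (hwpos i hi).le (mul_self_nonneg _)).mp hh
      have h1 := hterm 0 (by simp)
      rw [hqe, Nat.cast_zero, hahnQ_zero_right, mul_one, mul_one] at h1
      exact (hwpos 0 (by simp)).ne' h1
    have hk0 := hqc n (by omega)
    have hk1 : |(q (n + 1)).coeff (n + 1)| = |hahnCoeff (n + 1 : ℕ) α N (n + 1)| := by
      rw [hq, coeff_hahnPoly, abs_mul, abs_pow, abs_neg, abs_one, one_pow, one_mul]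
    rw [abs_mul, ← hk1]
    refine (mul_le_mul_of_nonneg_left hsum (abs_nonneg _)).trans_eq ?_
    rw [abs_div, abs_mul, abs_mul]
    have h1 := abs_pos.mpr hm0
    have h2 := abs_pos.mpr hk0
    have h3 := abs_pos.mpr (hqc (n + 1) le_rfl)
    field_simp
  have hNpos : (0 : ℝ) < N := by exact_mod_cast (by omega : 0 < N)
  have hclosure : closure (Set.Ioo (0 : ℝ) N ∩ (↑T : Set ℝ)ᶜ) = Set.Icc (0 : ℝ) N := by
    have hd : Dense ((↑T : Set ℝ)ᶜ) := T.finite_toSet.countable.dense_compl ℝ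
    refine (closure_minimal (Set.inter_subset_left.trans Set.Ioo_subset_Icc_self)
      isClosed_Icc).antisymm ?_
    rw [← closure_Ioo hNpos.ne]
    exact closure_minimal (hd.open_subset_closure_inter isOpen_Ioo) isClosed_closure
  refine le_on_closure hgeneric ?_ continuousOn_const (hclosure.symm ▸ hx)
  rw [hclosure]
  refine (hFc.sub (Continuous.continuousOn ?_)).abs
  refine continuous_finsetSum _ fun k _ => continuous_const.mul ?_
  have hk : hahnQ k α α N = fun y => (q k).eval y := funext fun y => (hqe k y).symm
  rw [hk]
  exact (q k).continuous

end HahnRemainder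

section GammaBound

theorem pochhammer_eq_Gamma_div {a : ℝ} (ha : 0 < a) (k : ℕ) :
    pochhammer a k = Real.Gamma (a + k) / Real.Gamma a := by
  have hG := (Real.Gamma_pos_of_pos ha).ne'
  induction k with
  | zero => simp [pochhammer_zero_right, hG]
  | succ k ih =>
    have hk : a + k ≠ 0 := by positivity
    rw [pochhammer_succ_right, ih, Nat.cast_succ, ← add_assoc, Real.Gamma_add_one hk]
    ring

theorem Gamma_add_le_rpow_mul_Gamma {z s : ℝ} (hz : 0 < z) (hs : 0 < s) :
    Real.Gamma (z + s) ≤ (z + s) ^ s * Real.Gamma z := by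
  have hzs : 0 < z + s := by positivity
  have h := Real.convexOn_log_Gamma.slope_mono_adjacent (x := z) (y := z + s) (z := z + s + 1)
    (Set.mem_Ioi.mpr hz) (Set.mem_Ioi.mpr (by positivity)) (by linarith) (by linarith)
  simp only [Function.comp_apply] at h
  have hG := Real.Gamma_pos_of_pos hz
  have hGs := Real.Gamma_pos_of_pos hzs
  rw [Real.Gamma_add_one hzs.ne', Real.log_mul hzs.ne' hGs.ne', add_sub_cancel_left,
    add_sub_cancel_right, add_sub_cancel_left, div_one, div_le_iff₀ hs] at h
  rw [← Real.log_le_log_iff hGs (by positivity), Real.log_mul (by positivity) hG.ne',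
    Real.log_rpow hzs]
  linarith

/-- The error term of the asymptotic bound. -/
noncomputable def gammaError (α : ℝ) (n : ℕ) : ℝ :=
  (α + 1 / 2) * (2 * α + 2) * Real.exp ((α + 1 / 2) * (2 * α + 2)) * (n : ℝ)⁻¹

theorem rpow_le_one_add_gammaError {α : ℝ} (hα : -(1 / 2 : ℝ) < α) {n : ℕ} (hn : 1 ≤ n) :
    ((n : ℝ) + 2 * α + 2) ^ (α + 1 / 2) ≤ (n : ℝ) ^ (α + 1 / 2) * (1 + gammaError α n) := by
  have hn1 : (1 : ℝ) ≤ n := by exact_mod_cast hn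
  have hn0 : (0 : ℝ) < n := by linarith
  have hs : 0 < α + 1 / 2 := by linarith
  have hc : 0 < 2 * α + 2 := by linarith
  set c := 2 * α + 2 with hcdef
  set s := α + 1 / 2 with hsdef
  have h1 : (n : ℝ) + 2 * α + 2 = n * (1 + c / n) := by
    rw [hcdef]
    field_simp
    ring
  rw [h1, Real.mul_rpow hn0.le (by positivity)]
  gcongr
  have h2 : 1 + c / n ≤ Real.exp (c / n) := by linarith [Real.add_one_le_exp (c / n)]
  have h3 : (1 + c / n) ^ s ≤ Real.exp (s * c / n) := by
    refine (Real.rpow_le_rpow (by positivity) h2 hs.le).trans_eq ?_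
    rw [← Real.exp_mul]
    congr 1
    ring
  set t := s * c / n with ht
  have ht0 : 0 < t := by positivity
  have htle : t ≤ s * c := div_le_self (by positivity) hn1
  have h4 : Real.exp t ≤ 1 + t * Real.exp t := by
    have h5 := Real.add_one_le_exp (-t)
    have h6 : Real.exp (-t) * Real.exp t = 1 := by rw [← Real.exp_add]; simp
    nlinarith [Real.exp_pos t]
  calc (1 + c / n) ^ s ≤ 1 + t * Real.exp t := h3.trans h4
    _ ≤ 1 + t * Real.exp (s * c) := by gcongr
    _ = 1 + gammaError α n := by
      rw [gammaError, ht]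
      ring

theorem pochhammer_div_le {α : ℝ} (hα : -(1 / 2 : ℝ) < α) {n : ℕ} (hn : 1 ≤ n) :
    2 ^ (n + 1) * (pochhammer (α + 1) (n + 1) / pochhammer (n + 2 * α + 2) (n + 1)) ≤
      Real.sqrt (Real.pi * n) / 2 ^ (n + 1) *
        ((n : ℝ) ^ α / (Real.Gamma (α + 1) * (2 : ℝ) ^ (2 * α))) * (1 + gammaError α n) := by
  have hn1 : (1 : ℝ) ≤ n := by exact_mod_cast hn
  have hn0 : (0 : ℝ) < n := by linarith
  have hs : 0 < α + 1 / 2 := by linarith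
  set z : ℝ := n + α + 3 / 2 with hz
  have hz0 : 0 < z := by rw [hz]; linarith
  have hGa := Real.Gamma_pos_of_pos (show 0 < α + 1 by linarith)
  have hGz := Real.Gamma_pos_of_pos hz0
  have hG2z := Real.Gamma_pos_of_pos (show 0 < 2 * z by linarith)
  have hG2 := Real.Gamma_pos_of_pos (show 0 < (n : ℝ) + 2 * α + 2 by linarith)
  have hdup := Real.Gamma_mul_Gamma_add_half z
  have hgam := Gamma_add_le_rpow_mul_Gamma hz0 hs
  rw [show z + (α + 1 / 2) = (n : ℝ) + 2 * α + 2 by rw [hz]; ring] at hgam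
  have hgam' := hgam.trans (mul_le_mul_of_nonneg_right (rpow_le_one_add_gammaError hα hn) hGz.le)
  have hpow : (2 : ℝ) ^ (1 - 2 * z) = ((2 : ℝ) ^ (n + 1) * 2 ^ (n + 1) * (2 : ℝ) ^ (2 * α))⁻¹ := by
    rw [← Real.rpow_natCast, ← Real.rpow_add two_pos, ← Real.rpow_add two_pos,
      ← Real.rpow_neg two_pos.le]
    congr 1
    rw [hz]
    push_cast
    ring
  have hsqrt : Real.sqrt Real.pi * (n : ℝ) ^ (α + 1 / 2) =
      Real.sqrt (Real.pi * n) * (n : ℝ) ^ α := by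
    rw [Real.rpow_add hn0, ← Real.sqrt_eq_rpow, Real.sqrt_mul Real.pi_pos.le]
    ring
  rw [pochhammer_eq_Gamma_div (show 0 < α + 1 by linarith),
    pochhammer_eq_Gamma_div (show 0 < (n : ℝ) + 2 * α + 2 by linarith)]
  push_cast
  rw [show α + 1 + ((n : ℝ) + 1) = z + 1 / 2 by rw [hz]; ring,
    show (n : ℝ) + 2 * α + 2 + (n + 1) = 2 * z by rw [hz]; ring]
  have hhalf : Real.Gamma (z + 1 / 2) =
      Real.Gamma (2 * z) * 2 ^ (1 - 2 * z) * Real.sqrt Real.pi / Real.Gamma z := by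
    rw [eq_div_iff hGz.ne', ← hdup, mul_comm]
  have hp : (0 : ℝ) < 2 ^ (n + 1) := by positivity
  have hp2 : (0 : ℝ) < 2 ^ (2 * α) := by positivity
  calc _ = Real.sqrt Real.pi / (2 ^ (n + 1) * 2 ^ (2 * α) * Real.Gamma (α + 1) * Real.Gamma z) *
        Real.Gamma (n + 2 * α + 2) := by
        rw [hhalf, hpow]
        field_simp
    _ ≤ Real.sqrt Real.pi / (2 ^ (n + 1) * 2 ^ (2 * α) * Real.Gamma (α + 1) * Real.Gamma z) *
        ((n : ℝ) ^ (α + 1 / 2) * (1 + gammaError α n) * Real.Gamma z) := by gcongr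
    _ = (Real.sqrt Real.pi * (n : ℝ) ^ (α + 1 / 2)) /
        (2 ^ (n + 1) * 2 ^ (2 * α) * Real.Gamma (α + 1)) * (1 + gammaError α n) := by
        field_simp
    _ = _ := by
        rw [hsqrt]
        field_simp

end GammaBound

section MainResult

theorem degree_conditions_of_le_degreeBound {α : ℝ} (hα : -(1 / 2 : ℝ) < α) {n N : ℕ} (hn : 1 ≤ n)
    (h : (n : ℝ) + 1 ≤ degreeBound α N) :
    n + 2 ≤ N ∧ 2 * (n : ℝ) * (n + 2 * α + 1) ≤ N * (2 * α + 1) := by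
  have hn1 : (1 : ℝ) ≤ n := by exact_mod_cast hn
  have h1 : 2 * (n : ℝ) + 2 * α + 1 ≤
      Real.sqrt ((2 * α + 1) * (2 * α + 2 * (N : ℝ) + 1)) := by
    rw [degreeBound] at h
    linarith
  have h2 := (Real.le_sqrt' (by linarith)).mp h1
  have h3 : 2 * (n : ℝ) * (n + 2 * α + 1) ≤ N * (2 * α + 1) := by nlinarith
  refine ⟨?_, h3⟩
  have h4 : 2 * (n : ℝ) < N := by
    by_contra! hcon
    have := mul_le_mul_of_nonneg_right hcon (show 0 ≤ 2 * α + 1 by linarith)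
    nlinarith
  have : 2 * n < N := by exact_mod_cast h4
  omega

theorem abs_le_supNormI {g : ℝ → ℝ} (hg : ContinuousOn g (Set.Icc (-1) 1)) {x : ℝ}
    (hx : x ∈ Set.Icc (-1 : ℝ) 1) : |g x| ≤ supNormI g := by
  have hb : BddAbove (Set.range fun y : Set.Icc (-1 : ℝ) 1 => |g y|) := by
    have := (isCompact_Icc.image_of_continuousOn hg.abs).bddAbove
    rwa [Set.image_eq_range] at this
  exact le_ciSup hb ⟨x, hx⟩

theorem interpolationBound_comp_affine {N n : ℕ} (hN : 0 < N) {f : ℝ → ℝ}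
    (hf : ContDiffOn ℝ (n + 1 : ℕ) f (Set.Icc (-1) 1)) {M : ℝ}
    (hM : ∀ x ∈ Set.Icc (-1 : ℝ) 1, |iteratedDerivWithin (n + 1) f (Set.Icc (-1) 1) x| ≤ M) :
    InterpolationBound N n (fun y => f (2 / (N : ℝ) * y - 1))
      (M / ((n + 1).factorial : ℝ) * (2 / (N : ℝ)) ^ (n + 1)) := by
  intro s hs hcard
  have hN' : (0 : ℝ) < N := by exact_mod_cast hN
  have hmap (y : ℝ) (hy : y ∈ Set.Icc (0 : ℝ) N) :
      2 / (N : ℝ) * y - 1 ∈ Set.Icc (-1 : ℝ) 1 := by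
    have h1 : 0 ≤ 2 / (N : ℝ) * y := mul_nonneg (by positivity) hy.1
    have h2 : 2 / (N : ℝ) * y ≤ 2 / N * N := mul_le_mul_of_nonneg_left hy.2 (by positivity)
    rw [div_mul_cancel₀ _ hN'.ne'] at h2
    exact ⟨by linarith, by linarith⟩
  have hinj : Function.Injective fun y : ℝ => 2 / (N : ℝ) * y - 1 := by
    intro a b hab
    have h : 2 / (N : ℝ) * a = 2 / N * b := by simpa using hab
    exact mul_left_cancel₀ (by positivity) h
  set t : Finset ℝ := s.map ⟨_, hinj⟩ with ht
  have htcard : t.card = n + 1 := by rw [ht, Finset.card_map, hcard]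
  obtain ⟨p, hp, hpf⟩ := exists_polynomial_abs_sub_le (by norm_num : (-1 : ℝ) < 1) t
    (by
      intro y hy
      obtain ⟨z, hz, rfl⟩ := Finset.mem_map.mp hy
      exact hmap z (hs hz))
    f (by rwa [htcard]) (M := M) (by rwa [htcard])
  rw [htcard] at hp hpf
  refine ⟨p.comp (Polynomial.C (2 / (N : ℝ)) * Polynomial.X - Polynomial.C 1), ?_, ?_⟩
  · have h1 : p.natDegree ≤ n := by
      rcases eq_or_ne p 0 with rfl | hp0
      · simp
      · exact Nat.lt_succ_iff.mp ((Polynomial.natDegree_lt_iff_degree_lt hp0).mpr hp)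
    have h2 : (Polynomial.C (2 / (N : ℝ)) * Polynomial.X - Polynomial.C 1).natDegree ≤ 1 := by
      rw [Polynomial.natDegree_sub_C]
      exact (Polynomial.natDegree_C_mul_le _ _).trans Polynomial.natDegree_X_le
    refine Polynomial.degree_le_natDegree.trans_lt ?_
    have h3 : (p.comp (Polynomial.C (2 / (N : ℝ)) * Polynomial.X - Polynomial.C 1)).natDegree ≤
        n * 1 := Polynomial.natDegree_comp_le.trans (Nat.mul_le_mul h1 h2)
    exact_mod_cast (by omega : (p.comp _).natDegree < n + 1)
  · intro y hy
    have h := hpf _ (hmap y hy)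
    rw [ht, Finset.prod_map] at h
    simp only [Function.Embedding.coeFn_mk, Polynomial.eval_comp, Polynomial.eval_sub,
      Polynomial.eval_mul, Polynomial.eval_C, Polynomial.eval_X] at h ⊢
    refine h.trans_eq ?_
    have hz (z : ℝ) : |2 / (N : ℝ) * y - 1 - (2 / N * z - 1)| = 2 / N * |y - z| := by
      rw [show 2 / (N : ℝ) * y - 1 - (2 / N * z - 1) = 2 / N * (y - z) by ring, abs_mul,
        abs_of_pos (by positivity)]
    simp only [hz, Finset.prod_mul_distrib, Finset.prod_const, hcard]
    ring

theorem supNormI_sub_hahnExpansion_le {α : ℝ} (hα : -(1 / 2 : ℝ) < α) {n N : ℕ} (hn : 1 ≤ n)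
    (hN : n + 2 ≤ N) (hdeg : 2 * (n : ℝ) * (n + 2 * α + 1) ≤ N * (2 * α + 1)) {f : ℝ → ℝ}
    (hf : ContDiffOn ℝ (n + 1 : ℕ) f (Set.Icc (-1) 1)) :
    supNormI (fun x => f x - hahnExpansion α α N n f x) ≤
      supNormI (iteratedDerivWithin (n + 1) f (Set.Icc (-1) 1)) / ((n + 1).factorial : ℝ) *
        (2 ^ (n + 1) * (pochhammer (α + 1) (n + 1) / pochhammer (n + 2 * α + 2) (n + 1))) := by
  have hN' : (0 : ℝ) < N := by exact_mod_cast (by omega : 0 < N)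
  set M := supNormI (iteratedDerivWithin (n + 1) f (Set.Icc (-1) 1)) with hMdef
  have hcont : ContinuousOn (iteratedDerivWithin (n + 1) f (Set.Icc (-1) 1)) (Set.Icc (-1) 1) :=
    hf.continuousOn_iteratedDerivWithin le_rfl (uniqueDiffOn_Icc (by norm_num))
  have hM0 : 0 ≤ M := Real.iSup_nonneg fun _ => abs_nonneg _
  have hI := interpolationBound_comp_affine (by omega : 0 < N) hf (M := M)
    fun x hx => abs_le_supNormI hcont hx
  have hFc : ContinuousOn (fun y => f (2 / (N : ℝ) * y - 1)) (Set.Icc (0 : ℝ) N) := by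
    refine hf.continuousOn.comp (by fun_prop) fun y hy => ?_
    have h1 : 0 ≤ 2 / (N : ℝ) * y := mul_nonneg (by positivity) hy.1
    have h2 : 2 / (N : ℝ) * y ≤ 2 / N * N := mul_le_mul_of_nonneg_left hy.2 (by positivity)
    rw [div_mul_cancel₀ _ hN'.ne'] at h2
    exact ⟨by linarith, by linarith⟩
  have : Nonempty (Set.Icc (-1 : ℝ) 1) := ⟨⟨0, by norm_num, by norm_num⟩⟩
  refine ciSup_le fun ⟨x, hx⟩ => ?_
  have hy : (N : ℝ) / 2 * (1 + x) ∈ Set.Icc (0 : ℝ) N := by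
    refine ⟨mul_nonneg (by positivity) (by linarith [hx.1]), ?_⟩
    have := mul_le_mul_of_nonneg_left (show 1 + x ≤ 2 by linarith [hx.2])
      (show (0 : ℝ) ≤ N / 2 by positivity)
    linarith
  have hmain := abs_sub_sum_hahnQ_le hα hn hN hdeg _ hFc _ (by positivity) hI hy
  have hback : 2 / (N : ℝ) * (N / 2 * (1 + x)) - 1 = x := by
    field_simp
    ring
  simp only [hback] at hmain
  simp only [hahnExpansion]
  refine hmain.trans ?_
  have hk := inv_abs_hahnCoeff_self_le (k := n + 1) (N := N) hα
  rw [show ((n + 1 : ℕ) : ℝ) + 2 * α + 1 = n + 2 * α + 2 by push_cast; ring] at hk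
  refine (mul_le_mul_of_nonneg_left hk (by positivity)).trans_eq ?_
  rw [div_pow]
  field_simp

end MainResult

theorem mainTheorem2 (α : ℝ) (hα : -(1 / 2 : ℝ) < α) :
    ∃ ε : ℕ → ℝ, (ε =O[atTop] fun n : ℕ => ((n : ℝ))⁻¹) ∧
      ∀ n : ℕ, 1 ≤ n → ∀ N : ℕ, 1 ≤ N → (n : ℝ) + 1 ≤ degreeBound α N →
        ∀ f : ℝ → ℝ, ContDiffOn ℝ ((n + 1 : ℕ) : ℕ∞) f (Set.Icc (-1) 1) →
          supNormI (fun x => f x - hahnExpansion α α N n f x) ≤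
            supNormI (iteratedDerivWithin (n + 1) f (Set.Icc (-1) 1)) *
              (Real.sqrt (Real.pi * (n : ℝ)) / (2 ^ (n + 1) * ((n + 1).factorial : ℝ)) *
                ((n : ℝ) ^ α / (Real.Gamma (α + 1) * (2 : ℝ) ^ (2 * α))) * (1 + ε n)) := by
  refine ⟨gammaError α, isBigO_const_mul_self _ _ _, fun n hn N _ hdeg f hf => ?_⟩
  obtain ⟨hN, hdeg'⟩ := degree_conditions_of_le_degreeBound hα hn hdeg
  refine (supNormI_sub_hahnExpansion_le hα hn hN hdeg' (by exact_mod_cast hf)).trans ?_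
  have hM0 : 0 ≤ supNormI (iteratedDerivWithin (n + 1) f (Set.Icc (-1) 1)) :=
    Real.iSup_nonneg fun _ => abs_nonneg _
  refine (mul_le_mul_of_nonneg_left (pochhammer_div_le hα hn) (by positivity)).trans_eq ?_
  field_simp
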